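/- **Setting.** A two-player zero-sum episodic Markov game with horizon $H\ge 1$ has a measurable state space $\mathcal S$ (possibly infinite), a finite action set $\mathcal A$ for each player, deterministic rewards $r_h(x,a,b)$, transition kernels $\mathbb P_h(\cdot\mid x,a,b)$, $h\in[H]$, and a fixed initial state $x_1$. P1 plays $\pi=(\pi_h)$, P2 plays $\nu=(\nu_h)$, with $\pi_h,\nu_h:\mathcal S\to\Delta(\mathcal A)$ measurable, and $V_h^{\pi,\nu}(x)$ is the expected sum of the rewards from step $h$ on, started at $x_h=x$ ($V_{H+1}=0$). Let $V^{\pi,\nu^*_\pi}(x_1)=\min_\nu V_1^{\pi,\nu}(x_1)$ and $V^*(x_1)=\max_\pi\min_\nu V_1^{\pi,\nu}(x_1)$, the value of a Nash equilibrium. Let $M^*$ be the true game and $\mathcal M$ a finite class of games (models) on the same $\mathcal S,\mathcal A,H$; write $(r,x')\sim M_h(x,a,b)$ for the reward and next state in the model $M$ at step $h$, and $V_{M,h}^{\pi,\nu}$ for its value functions. Let $\pi^M$ be P1's part of a Nash equilibrium of $M$ (started at $x_1$) and $\nu^{M}_{\pi}$ a best response of P2 to $\pi$ in $M$. Let $\mathcal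 G$ be a finite nonempty class of measurable test functions $g(x,a,b,r,x')$ with $|g|\le 1$. All rewards of models in $\mathcal M$ lie in $[-1,1]$, and values are normalized: $|V_{M,h}^{\pi,\nu}(x)|\le 1$ for all $M\in\mathcal M$, $\pi,\nu,h,x$. For $M_1,M_2,M\in\mathcal M$ and $h\in[H]$, with $(x_h,a_h,b_h,r_h,x_{h+1})$ generated in $M^*$ by the policies $\pi=\pi^{M_1}$, $\nu=\nu^{M_2}_{\pi^{M_1}}$, define $$\mathcal E(M_1,M_2,M,h)=\max_{g\in\mathcal G}\mathbb E\Big[\mathbb E_{(r,x')\sim M_h(x_h,a_h,b_h)}[g(x_h,a_h,b_h,r,x')]-g(x_h,a_h,b_h,r_h,x_{h+1})\Big],$$ $$\mathcal L(M_1,M_2,M,h)=\mathbb E\Big[\mathbb E_{(r,x')\sim M_h(x_h,a_h,b_h)}[r+V_{M,h+1}^{\pi,\nu}(x')]-r_h-V_{M,h+1}^{\pi,\nu}(x_{h+1})\Big].$$ For $\kappa\in(0,1]$ let $\mathcal N_{\kappa,h}$ be the set of matrices $B\in\mathbb R^{\mathcal M^2\times\mathcal M}$ with $\kappa|\mathcal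 L(M_1,M_2,M,h)|\le B_{(M_1,M_2),M}\le\mathcal E(M_1,M_2,M,h)$ for all $M_1,M_2,M$. Let $\mathrm{rank}(B,\beta)$ be the least $k$ such that $B=UV^\top$ with $U,V$ having $k$ columns and $\|u\|_2\|v\|_2\le\beta$ for all rows $u$ of $U$ and $v$ of $V$. The witness rank is $W_\kappa=\max_{h\in[H]}\min_{B\in\mathcal N_{\kappa,h}}\mathrm{rank}(B,\beta)$, with value $\infty$ if there is no such factorization. **Algorithm** (alternate optimistic model elimination), with parameters $\phi>0$ and $n_1,n\in\mathbb N$. Put $\mathcal M^0=\mathcal M$. In round $k=1,2,\dots$: 1. choose $M_1^k\in\arg\max_{M\in\mathcal M^{k-1}}V_{M,1}^{\pi^M,\nu^M_{\pi^M}}(x_1)$ and put $\pi^k=\pi^{M_1^k}$; choose $M_2^k\in\arg\min_{M\in\mathcal M^{k-1}}V_{M,1}^{\pi^k,\nu^M_{\pi^k}}(x_1)$ and put $\nu^k=\nu^{M_2^k}_{\pi^k}$; 2. sample $n_1$ trajectories of $(\pi^k,\nu^k)$ in $M^*$; let $\hat V^k$ be their average return and $\hat{\mathcal L}(M_1^k,M_2^k,M,h)$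 the empirical average corresponding to $\mathcal L(M_1^k,M_2^k,M,h)$; 3. if $|\hat V^k-V_{M_i^k,1}^{\pi^k,\nu^k}(x_1)|\le\epsilon/2$ for $i=1,2$, stop and output $\pi^k$; 4. otherwise choose $h^k$ with $\max_{i}|\hat{\mathcal L}(M_1^k,M_2^k,M_i^k,h^k)|\ge\epsilon/(4H)$, sample $n$ fresh trajectories of $(\pi^k,\nu^k)$, form from them the empirical version $\hat{\mathcal E}$ of $\mathcal E$ (maximum over $g$ of empirical averages), and put $\mathcal M^k=\{M\in\mathcal M^{k-1}:\hat{\mathcal E}(M_1^k,M_2^k,M,h^k)\le\phi\}$. (If $\mathcal M^{k-1}$ is empty or no admissible $h^k$ exists, the algorithm fails.) Optimizers and $h^k$ are chosen by arbitrary fixed rules: functions of $\mathcal M^{k-1}$ for $M_1^k,M_2^k$, and of $\mathcal M^{k-1}$ and (measurably) the values $\hat{\mathcal L}(M_1^k,M_2^k,M_i^k,h)$ for $h^k$. **Theorem.** There is an absolute constant $C_0>0$ such that for every $C\ge C_0$ there is $C'>0$, depending only on $C$, with the following property. Let $\epsilon,p,\kappa\in(0,1]$, and in the setting above assume realizability,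 $M^*\in\mathcal M$, and witness-rank domination, $1\le W_\kappa<\infty$, with $\beta\ge\kappa\epsilon/(8H)$. Put $$\phi=\frac{\kappa\epsilon}{100H\sqrt{W_\kappa}},\qquad T=HW_\kappa\log\frac{\beta}{2\phi},\qquad n_1=\Big\lceil\frac{CH^2\log(HT/p)}{\epsilon^2}\Big\rceil,\qquad n=\Big\lceil\frac{CH^2W_\kappa|\mathcal A|\log(T|\mathcal M||\mathcal G|/p)}{(\kappa\epsilon)^2}\Big\rceil .$$ Then with probability at least $1-p$ the algorithm terminates with a policy $\pi$ such that $$V^*(x_1)-V^{\pi,\nu^*_\pi}(x_1)\le\epsilon,$$ and has sampled by then at most $$C'\,\frac{H^3W_\kappa^2|\mathcal A|}{\kappa^2\epsilon^2}\,\log\frac{\beta}{2\phi}\,\log\frac{T|\mathcal G||\mathcal M|}{p}$$ trajectories. -/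

import Mathlib

open MeasureTheory ProbabilityTheory

noncomputable section

namespace AOME

/-- A two-player zero-sum simultaneous-move episodic Markov game (equivalently, a model of one) with
state space `S` and common action space `A`.  Steps are numbered `0, 1, …, H - 1`, where the horizon
`H` is a parameter of the notions below; the data at steps `h ≥ H` play no role. -/
structure MarkovGame (S A : Type*) [MeasurableSpace S] [MeasurableSpace A] where
  /-- the deterministic reward `r_h(x, a, b)` -/
  reward : ℕ → S × (A × A) → ℝ
  measurable_reward : ∀ h, Measurable (reward h)
  /-- the transition kernel `P_h(· | x, a, b)` -/
  trans : ℕ → Kernel (S × (A × A)) S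
  isMarkov : ∀ h, IsMarkovKernel (trans h)

/-- A stochastic Markov policy: at step `h` in state `x` the action is drawn from `act h x`. -/
structure Policy (S A : Type*) [MeasurableSpace S] [MeasurableSpace A] where
  act : ℕ → Kernel S A
  isMarkov : ∀ h, IsMarkovKernel (act h)

/-- What is observed in one step: `((x_h, (a_h, b_h)), (r_h, x_{h+1}))`. -/
abbrev Obs (S A : Type*) := (S × (A × A)) × (ℝ × S)

section Game

variable {S A : Type*} [MeasurableSpace S] [MeasurableSpace A]

/-- The law of `(r, x')` given `(x, a, b)` at step `h` of the game `M`. -/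
def MarkovGame.outcome (M : MarkovGame S A) (h : ℕ) : Kernel (S × (A × A)) (ℝ × S) :=
  Kernel.deterministic (M.reward h) (M.measurable_reward h) ×ₖ M.trans h

/-- The law of the observation at step `h` from state `x`, when the players use `π` and `ν`
(independently of each other). -/
def stepLaw (M : MarkovGame S A) (π ν : Policy S A) (h : ℕ) : Kernel S (Obs S A) :=
  (Kernel.id ×ₖ (π.act h ×ₖ ν.act h)) ⊗ₖ Kernel.prodMkLeft S (M.outcome h)

/-- The law of the observations at the `n` steps `h, h + 1, …, h + n - 1`, started from the state
`x` at step `h`, when the players use `π` and `ν` in the game `M`. -/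
def trajLaw (M : MarkovGame S A) (π ν : Policy S A) : (n : ℕ) → ℕ → Kernel S (Fin n → Obs S A)
  | 0, _ => Kernel.const S (Measure.dirac Fin.elim0)
  | n + 1, h =>
    (stepLaw M π ν h ⊗ₖ
        (trajLaw M π ν n (h + 1)).comap (fun q : S × Obs S A => q.2.2.2) (by fun_prop)).map
      (fun q => (Fin.cons q.1 q.2 : Fin (n + 1) → Obs S A))

/-- `V_h^{π,ν}(x)` in the game `M` with horizon `H`: the expected sum of the rewards at the steps
`h, …, H - 1` from the state `x` at step `h`. -/
def value (M : MarkovGame S A) (H : ℕ) (π ν : Policy S A) (h : ℕ) (x : S) : ℝ :=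
  ∫ τ, ∑ i, (τ i).2.1 ∂(trajLaw M π ν (H - h) h x)

/-- `(π, ν)` is a Nash equilibrium of `M` started from `x₁`. -/
def IsNash (M : MarkovGame S A) (H : ℕ) (x₁ : S) (π ν : Policy S A) : Prop :=
  (∀ π', value M H π' ν 0 x₁ ≤ value M H π ν 0 x₁) ∧
    ∀ ν', value M H π ν 0 x₁ ≤ value M H π ν' 0 x₁

/-- `ν` is a best response of the second player to `π` in `M` started from `x₁`. -/
def IsBestResponse (M : MarkovGame S A) (H : ℕ) (x₁ : S) (π ν : Policy S A) : Prop :=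
  ∀ ν', value M H π ν 0 x₁ ≤ value M H π ν' 0 x₁

/-- `V^{π, ν*_π}(x₁)`: the value of `π` against a best response. -/
def worstValue (M : MarkovGame S A) (H : ℕ) (x₁ : S) (π : Policy S A) : ℝ :=
  ⨅ ν : Policy S A, value M H π ν 0 x₁

/-- `V*(x₁)`: the value of the game, which is the value of every Nash equilibrium. -/
def gameValue (M : MarkovGame S A) (H : ℕ) (x₁ : S) : ℝ :=
  ⨆ π : Policy S A, worstValue M H x₁ π

/-- `E_{(r,x') ∼ M(x_h,a_h,b_h)} [f(x_h,a_h,b_h,r,x')] - f(x_h,a_h,b_h,r_h,x_{h+1})`, a function of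
the observation `z` at step `h`. -/
def misfit (M : MarkovGame S A) (h : ℕ) (f : Obs S A → ℝ) (z : Obs S A) : ℝ :=
  (∫ y, f (z.1, y) ∂(M.outcome h z.1)) - f z

/-- The function `r + V_{h+1}^{π,ν}(x')`, with the value function of the model `M`. -/
def bellmanTest (M : MarkovGame S A) (H : ℕ) (π ν : Policy S A) (h : ℕ) (z : Obs S A) : ℝ :=
  z.2.1 + value M H π ν (h + 1) z.2.2

/-- The witnessed model misfit at step `h` of the model `M`, along trajectories of `(π, ν)` in the
true game `Mtrue`, for the class `g` of test functions. -/
def witnessMisfit {γ : Type*} (Mtrue M : MarkovGame S A) (H : ℕ) (x₁ : S) (g : γ → Obs S A → ℝ)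
    (π ν : Policy S A) (h : Fin H) : ℝ :=
  ⨆ c : γ, ∫ τ, misfit M h (g c) (τ h) ∂(trajLaw Mtrue π ν H 0 x₁)

/-- The Bellman error at step `h` of the model `M`, along trajectories of `(π, ν)` in the true game
`Mtrue`. -/
def bellmanError (Mtrue M : MarkovGame S A) (H : ℕ) (x₁ : S) (π ν : Policy S A) (h : Fin H) : ℝ :=
  ∫ τ, misfit M h (bellmanTest M H π ν h) (τ h) ∂(trajLaw Mtrue π ν H 0 x₁)

/-! Empirical versions, from `n` trajectories. -/

/-- The average return. -/
def empValue {H n : ℕ} (D : Fin n → Fin H → Obs S A) : ℝ :=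
  (n : ℝ)⁻¹ * ∑ j, ∑ h, (D j h).2.1

/-- The empirical Bellman error. -/
def empBellmanError {H n : ℕ} (M : MarkovGame S A) (π ν : Policy S A)
    (D : Fin n → Fin H → Obs S A) (h : Fin H) : ℝ :=
  (n : ℝ)⁻¹ * ∑ j, misfit M h (bellmanTest M H π ν h) (D j h)

/-- The empirical witnessed model misfit. -/
def empWitnessMisfit {γ : Type*} {H n : ℕ} (M : MarkovGame S A) (g : γ → Obs S A → ℝ)
    (D : Fin n → Fin H → Obs S A) (h : Fin H) : ℝ :=
  ⨆ c : γ, (n : ℝ)⁻¹ * ∑ j, misfit M h (g c) (D j h)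

end Game

/-! ### Witness rank -/

/-- `rank(B, β)`: the least `k` such that `B = U Vᵀ` where `U`, `V` have `k` columns and
`‖u‖₂ ‖v‖₂ ≤ β` for every row `u` of `U` and every row `v` of `V` (`⊤` if there is no such `k`). -/
def boundedRank {I J : Type*} (B : Matrix I J ℝ) (β : ℝ) : ℕ∞ :=
  ⨅ k ∈ {k : ℕ | ∃ (U : I → EuclideanSpace ℝ (Fin k)) (V : J → EuclideanSpace ℝ (Fin k)),
      (∀ i j, B i j = inner ℝ (U i) (V j)) ∧ ∀ i j, ‖U i‖ * ‖V j‖ ≤ β}, (k : ℕ∞)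

section Algorithm

variable {S A ι : Type*} [MeasurableSpace S] [MeasurableSpace A]

/-- The planning steps of the algorithm for the models `𝓜 m`, `m : ι`, with an arbitrary choice
among the optimizers. -/
structure Planner (𝓜 : ι → MarkovGame S A) (H : ℕ) (x₁ : S) (ε : ℝ) where
  /-- `π^M`, a Nash policy of the first player in the model `M` -/
  pi : ι → Policy S A
  pi_spec : ∀ m, ∃ ν, IsNash (𝓜 m) H x₁ (pi m) ν
  /-- `nu M₁ M₂` is `ν^{M₂}_{π^{M₁}}`, a best response to `π^{M₁}` in the model `M₂` -/
  nu : ι → ι → Policy S A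
  nu_spec : ∀ m₁ m₂, IsBestResponse (𝓜 m₂) H x₁ (pi m₁) (nu m₁ m₂)
  /-- the optimistic model `M₁` in a set `s` of models -/
  opt : Finset ι → ι
  opt_mem : ∀ s, s.Nonempty → opt s ∈ s
  opt_max : ∀ s, ∀ m ∈ s, value (𝓜 m) H (pi m) (nu m m) 0 x₁ ≤
    value (𝓜 (opt s)) H (pi (opt s)) (nu (opt s) (opt s)) 0 x₁
  /-- the pessimistic model `M₂` in `s`, given the policy `π^{M₁}` of the optimistic one -/
  pess : Finset ι → ι
  pess_mem : ∀ s, s.Nonempty → pess s ∈ s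
  pess_min : ∀ s, ∀ m ∈ s, value (𝓜 (pess s)) H (pi (opt s)) (nu (opt s) (pess s)) 0 x₁ ≤
    value (𝓜 m) H (pi (opt s)) (nu (opt s) m) 0 x₁
  /-- the step selected from the empirical Bellman errors `ℓ i h` of the two models -/
  step : Finset ι → (Fin 2 → Fin H → ℝ) → Fin H
  step_measurable : ∀ s, Measurable (step s)
  step_spec : ∀ s (ℓ : Fin 2 → Fin H → ℝ), (∃ h i, ε / (4 * H) ≤ |ℓ i h|) → ∃ i, ε / (4 * H) ≤ |ℓ i (step s ℓ)|

variable {𝓜 : ι → MarkovGame S A} {H : ℕ} {x₁ : S} {ε : ℝ} {γ : Type*}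

/-- `N_{κ,h}`: the matrices with rows indexed by pairs of models and columns indexed by models that
lie entrywise between `κ |Bellman error|` and the witnessed model misfit. -/
def witnessMatrices (Mtrue : MarkovGame S A) (P : Planner 𝓜 H x₁ ε) (g : γ → Obs S A → ℝ) (κ : ℝ)
    (h : Fin H) : Set (Matrix (ι × ι) ι ℝ) :=
  {B | ∀ m₁ m₂ m,
    κ * |bellmanError Mtrue (𝓜 m) H x₁ (P.pi m₁) (P.nu m₁ m₂) h| ≤ B (m₁, m₂) m ∧
      B (m₁, m₂) m ≤ witnessMisfit Mtrue (𝓜 m) H x₁ g (P.pi m₁) (P.nu m₁ m₂) h}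

/-- `W_κ = max_h W(κ, β, 𝓜, 𝓖, h)` with `W(κ, β, 𝓜, 𝓖, h) = min {rank(B, β) | B ∈ N_{κ,h}}`. -/
def witnessRank (Mtrue : MarkovGame S A) (P : Planner 𝓜 H x₁ ε) (g : γ → Obs S A → ℝ)
    (κ β : ℝ) : ℕ∞ :=
  ⨆ h : Fin H, ⨅ B ∈ witnessMatrices Mtrue P g κ h, boundedRank B β

/-- The state of the algorithm between rounds; `used` is the number of trajectories sampled. -/
inductive Status (ι : Type*) where
  /-- still running, with the constraint set `s` -/
  | running (s : Finset ι) (used : ℕ)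
  /-- terminated with the output `π^M`, `M = 𝓜 m` -/
  | output (m : ι) (used : ℕ)
  /-- broken down: the constraint set is empty, or no step has a large empirical Bellman error -/
  | failed

instance : MeasurableSpace (Status ι) := ⊤

/-- The first or the second of the two models selected in a round. -/
def Planner.sel (P : Planner 𝓜 H x₁ ε) (s : Finset ι) (i : Fin 2) : ι :=
  if i = 0 then P.opt s else P.pess s

/-- The policy `π^k` of the first player in a round with constraint set `s`. -/
def Planner.roundPi (P : Planner 𝓜 H x₁ ε) (s : Finset ι) : Policy S A := P.pi (P.opt s)

/-- The policy `ν^k` of the second player in a round with constraint set `s`. -/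
def Planner.roundNu (P : Planner 𝓜 H x₁ ε) (s : Finset ι) : Policy S A :=
  P.nu (P.opt s) (P.pess s)

/-- The empirical Bellman errors of the two selected models. -/
def Planner.roundErr (P : Planner 𝓜 H x₁ ε) (s : Finset ι) {n₁ : ℕ}
    (D₁ : Fin n₁ → Fin H → Obs S A) (i : Fin 2) (h : Fin H) : ℝ :=
  empBellmanError (𝓜 (P.sel s i)) (P.roundPi s) (P.roundNu s) D₁ h

open Classical in
/-- One round of Alternate Optimistic Model Elimination, with constraint set `s`, first batch `D₁`
(for the estimates of the value and of the Bellman errors) and second batch `D₂` (for the estimate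
of the model misfit; sampled only if the algorithm does not stop in this round). -/
def Planner.round (P : Planner 𝓜 H x₁ ε) (g : γ → Obs S A → ℝ) (φ : ℝ) {n₁ n : ℕ}
    (s : Finset ι) (used : ℕ)
    (D : (Fin n₁ → Fin H → Obs S A) × (Fin n → Fin H → Obs S A)) : Status ι :=
  if ¬ s.Nonempty then Status.failed
  else if ∀ i, |empValue D.1 - value (𝓜 (P.sel s i)) H (P.roundPi s) (P.roundNu s) 0 x₁| ≤ ε / 2
    then Status.output (P.opt s) (used + n₁)
  else if ∃ h i, ε / (4 * H) ≤ |P.roundErr s D.1 i h|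
    then Status.running
      (s.filter fun m => empWitnessMisfit (𝓜 m) g D.2 (P.step s (P.roundErr s D.1)) ≤ φ)
      (used + n₁ + n)
  else Status.failed

/-- The law of the next status.  A running round samples `n₁ + n` independent trajectories of
`(π^k, ν^k)` in the true game. -/
def Planner.next (Mtrue : MarkovGame S A) (P : Planner 𝓜 H x₁ ε) (g : γ → Obs S A → ℝ) (φ : ℝ)
    (n₁ n : ℕ) : Status ι → Measure (Status ι)
  | Status.running s used =>
    ((Measure.pi fun _ : Fin n₁ => trajLaw Mtrue (P.roundPi s) (P.roundNu s) H 0 x₁).prod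
      (Measure.pi fun _ : Fin n => trajLaw Mtrue (P.roundPi s) (P.roundNu s) H 0 x₁)).map
      (P.round g φ s used)
  | Status.output m used => Measure.dirac (Status.output m used)
  | Status.failed => Measure.dirac Status.failed

/-- The law of the status after `k` rounds, started with the full model class. -/
def Planner.run [Fintype ι] (Mtrue : MarkovGame S A) (P : Planner 𝓜 H x₁ ε)
    (g : γ → Obs S A → ℝ) (φ : ℝ) (n₁ n : ℕ) : ℕ → Measure (Status ι)
  | 0 => Measure.dirac (Status.running Finset.univ 0)
  | k + 1 => (P.run Mtrue g φ n₁ n k).bind (P.next Mtrue g φ n₁ n)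

end Algorithm

/-- `φ = κ ε / (100 H √W)`. -/
def tol (H W : ℕ) (κ ε : ℝ) : ℝ := κ * ε / (100 * H * √(W : ℝ))

/-- `T = H W log (β / (2 φ))`. -/
def rounds (H W : ℕ) (κ β ε : ℝ) : ℝ := H * W * Real.log (β / (2 * tol H W κ ε))

/-- `n₁ = C H² log (H T / p) / ε²`, rounded up. -/
def batch₁ (C : ℝ) (H W : ℕ) (κ β ε p : ℝ) : ℕ :=
  ⌈C * H ^ 2 * Real.log (H * rounds H W κ β ε / p) / ε ^ 2⌉₊

/-- `n = C H² W |A| log (T |𝓜| |𝓖| / p) / (κ ε)²`, rounded up. -/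
def batch₂ (C : ℝ) (H W cardA cardM cardG : ℕ) (κ β ε p : ℝ) : ℕ :=
  ⌈C * H ^ 2 * W * cardA * Real.log (rounds H W κ β ε * cardM * cardG / p) / (κ * ε) ^ 2⌉₊

end AOME

end

/-! Suppose that every estimate of every round is accurate. The true model has zero misfit against
every test function, so it is never eliminated. Hence the optimistic model overestimates $V^*$, the
pessimistic one underestimates the worst-case value of $\pi^k$, and both claims concern the same
pair $(\pi^k,\nu^k)$. Stopping means that both predictions lie within $\epsilon/2$ of one empirical
return, which gives a gap of at most $\epsilon$ (`gameValue_sub_worstValue_le`). If the algorithm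
does not stop, one of the two models predicts a wrong value. The error of a predicted value is the
sum over $h$ of the Bellman errors (`sum_bellmanError`), so an admissible step exists
(`Planner.round_of_mem_accurateSamples`).

The number of rounds is bounded by a volume argument. For each $h$, factor a matrix of $\mathcal
N_{\kappa,h}$ as $\langle U,V\rangle$ with the rows of $V$ in the unit ball, and keep an ellipsoid
containing the vectors $V_m$ of all surviving models. In a round at step $h$ the row $u$ of $U$
satisfies $\langle u,V_m\rangle\ge\kappa\epsilon/(8H)$ for a selected model, but $0\le\langle
u,V_m\rangle\le 2\phi$ for all survivors. The ellipsoid can then be replaced by one whose volume is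
smaller by a factor $e$ (`HasEllipsoid.cut`). Every such ellipsoid contains the ball of radius
$2\phi/\beta$, so there are at most $W_\kappa\log(\beta/2\phi)$ cuts for each $h$, and at most $T$
in all (`EllipsoidInvariant.le`).

Accuracy in one round follows from Hoeffding's inequality and a union bound
(`measureReal_compl_accurateSamples_le`). The failure probabilities are added along the Markov chain
of statuses for $\lfloor T\rfloor+1$ rounds (`Planner.run_compl_goodStatus_le`), and
`mul_roundFailure_le` keeps the total below $p$. -/

namespace AOME

/-! ### Trajectory laws, Bellman equation and decomposition of value differences. -/

section Trajectories

variable {S A : Type*} [MeasurableSpace S] [MeasurableSpace A]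

instance (M : MarkovGame S A) (h : ℕ) : IsMarkovKernel (M.trans h) := M.isMarkov h

instance (π : Policy S A) (h : ℕ) : IsMarkovKernel (π.act h) := π.isMarkov h

instance (M : MarkovGame S A) (h : ℕ) : IsMarkovKernel (M.outcome h) := by
  unfold MarkovGame.outcome; infer_instance

instance (M : MarkovGame S A) (π ν : Policy S A) (h : ℕ) : IsMarkovKernel (stepLaw M π ν h) := by
  unfold stepLaw; infer_instance

theorem measurable_finCons {α : Type*} [MeasurableSpace α] (n : ℕ) :
    Measurable (fun q : α × (Fin n → α) => (Fin.cons q.1 q.2 : Fin (n + 1) → α)) := by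
  refine measurable_pi_lambda _ fun i => ?_
  refine Fin.cases ?_ (fun j => ?_) i
  · simpa using measurable_fst
  · simp only [Fin.cons_succ]
    exact (measurable_pi_apply j).comp measurable_snd

instance isMarkovKernel_trajLaw (M : MarkovGame S A) (π ν : Policy S A) (n h : ℕ) :
    IsMarkovKernel (trajLaw M π ν n h) := by
  induction n generalizing h with
  | zero => unfold trajLaw; infer_instance
  | succ n ih =>
    unfold trajLaw
    have := ih (h + 1)
    exact Kernel.IsMarkovKernel.map _ (measurable_finCons n)

theorem MarkovGame.outcome_apply (M : MarkovGame S A) (h : ℕ) (q : S × (A × A)) :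
    M.outcome h q = (M.trans h q).map (Prod.mk (M.reward h q)) := by
  rw [MarkovGame.outcome, Kernel.prod_apply, Kernel.deterministic_apply, Measure.dirac_prod]

theorem MarkovGame.ae_outcome_reward (M : MarkovGame S A) (h : ℕ) (q : S × (A × A)) :
    ∀ᵐ y ∂(M.outcome h q), y.1 = M.reward h q := by
  rw [M.outcome_apply, ae_map_iff (by fun_prop)
    (measurableSet_eq_fun measurable_fst measurable_const)]
  simp

theorem integral_stepLaw (M : MarkovGame S A) (π ν : Policy S A) (h : ℕ) (x : S)
    {f : Obs S A → ℝ} (hf : Integrable f (stepLaw M π ν h x)) :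
    ∫ z, f z ∂(stepLaw M π ν h x) =
      ∫ q, ∫ y, f (q, y) ∂(M.outcome h q) ∂((Kernel.id ×ₖ (π.act h ×ₖ ν.act h)) x) := by
  unfold stepLaw at hf ⊢
  rw [integral_compProd hf]
  simp [Kernel.prodMkLeft_apply]

theorem ae_stepLaw (M : MarkovGame S A) (π ν : Policy S A) (h : ℕ) (x : S)
    {p : Obs S A → Prop} (hp : MeasurableSet {z | p z})
    (hM : ∀ q, ∀ᵐ y ∂(M.outcome h q), p (q, y)) : ∀ᵐ z ∂(stepLaw M π ν h x), p z := by
  unfold stepLaw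
  rw [Kernel.ae_compProd_iff hp]
  exact Filter.Eventually.of_forall fun q => by simpa [Kernel.prodMkLeft_apply] using hM q

theorem ae_trajLaw_succ (M : MarkovGame S A) (π ν : Policy S A) (n h : ℕ) (x : S)
    {p : (Fin (n + 1) → Obs S A) → Prop} (hp : MeasurableSet {τ | p τ})
    (hz : ∀ᵐ z ∂(stepLaw M π ν h x),
      ∀ᵐ τ ∂(trajLaw M π ν n (h + 1) z.2.2), p (Fin.cons z τ)) :
    ∀ᵐ τ ∂(trajLaw M π ν (n + 1) h x), p τ := by
  rw [trajLaw, Kernel.map_apply _ (measurable_finCons n),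
    ae_map_iff (measurable_finCons n).aemeasurable hp]
  exact (Kernel.ae_compProd_iff (measurable_finCons n hp)).2 hz

theorem integral_trajLaw_succ (M : MarkovGame S A) (π ν : Policy S A) (n h : ℕ) (x : S)
    {f : (Fin (n + 1) → Obs S A) → ℝ} (hf : Measurable f)
    (hi : Integrable f (trajLaw M π ν (n + 1) h x)) :
    ∫ τ, f τ ∂(trajLaw M π ν (n + 1) h x) =
      ∫ z, ∫ τ, f (Fin.cons z τ) ∂(trajLaw M π ν n (h + 1) z.2.2) ∂(stepLaw M π ν h x) := by
  rw [trajLaw, Kernel.map_apply _ (measurable_finCons n)] at hi ⊢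
  rw [integral_map (measurable_finCons n).aemeasurable hf.aestronglyMeasurable, integral_compProd]
  · rfl
  · exact hi.comp_measurable (measurable_finCons n)

/-- The reward coordinate of an observation is an arbitrary real number, so bounds on rewards and
Bellman misfits hold only almost surely. This lemma transports them from single steps to whole
trajectories; `P` is indexed by the absolute step number. -/
theorem ae_trajLaw (M : MarkovGame S A) (π ν : Policy S A) {P : ℕ → Obs S A → Prop}
    (hP : ∀ j, MeasurableSet {z | P j z}) (n h : ℕ) (x : S)
    (hM : ∀ j, h ≤ j → j < h + n → ∀ x, ∀ᵐ z ∂(stepLaw M π ν j x), P j z) :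
    ∀ᵐ τ ∂(trajLaw M π ν n h x), ∀ i : Fin n, P (h + i) (τ i) := by
  induction n generalizing h x with
  | zero => exact Filter.Eventually.of_forall fun τ i => i.elim0
  | succ n ih =>
    refine ae_trajLaw_succ M π ν n h x ?_ ?_
    · rw [Set.ofPred_forall]
      exact MeasurableSet.iInter fun i => measurable_pi_apply i (hP _)
    · filter_upwards [hM h le_rfl (by omega) x] with z hz
      filter_upwards [ih (h + 1) z.2.2 fun j h1 h2 => hM j (by omega) (by omega)] with τ hτ
      refine Fin.cases (by simpa using hz) fun i => ?_
      have := hτ i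
      simpa [add_assoc, add_comm 1] using this

theorem ae_stepLaw_reward_le (M : MarkovGame S A) (π ν : Policy S A) (h : ℕ) (x : S)
    (hr : ∀ y, |M.reward h y| ≤ 1) : ∀ᵐ z ∂(stepLaw M π ν h x), |z.2.1| ≤ 1 := by
  refine ae_stepLaw M π ν h x (measurableSet_le (by fun_prop) measurable_const) fun q => ?_
  filter_upwards [M.ae_outcome_reward h q] with y hy
  simpa [hy] using hr q

theorem ae_trajLaw_reward_le (M : MarkovGame S A) (π ν : Policy S A) (n h : ℕ) (x : S)
    (hr : ∀ j, j < h + n → ∀ y, |M.reward j y| ≤ 1) :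
    ∀ᵐ τ ∂(trajLaw M π ν n h x), ∀ i, |(τ i).2.1| ≤ 1 :=
  ae_trajLaw M π ν (P := fun _ z => |z.2.1| ≤ 1)
    (fun _ => measurableSet_le (by fun_prop) measurable_const) n h x
    fun j _ hj x => ae_stepLaw_reward_le M π ν j x (hr j hj)

omit [MeasurableSpace S] [MeasurableSpace A] in
theorem abs_sum_reward_le {n : ℕ} {τ : Fin n → Obs S A} (hτ : ∀ i, |(τ i).2.1| ≤ 1) :
    |∑ i, (τ i).2.1| ≤ n :=
  (Finset.abs_sum_le_sum_abs _ _).trans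
    ((Finset.sum_le_sum fun i _ => hτ i).trans (by simp))

theorem measurable_sum_reward (n : ℕ) :
    Measurable fun τ : Fin n → Obs S A => ∑ i, (τ i).2.1 := by
  fun_prop

theorem measurable_value (M : MarkovGame S A) (H : ℕ) (π ν : Policy S A) (h : ℕ) :
    Measurable (value M H π ν h) := by
  have := StronglyMeasurable.integral_kernel_prod_right' (κ := trajLaw M π ν (H - h) h)
    (f := fun q : S × (Fin (H - h) → Obs S A) => ∑ i, (q.2 i).2.1)
    ((measurable_sum_reward _).comp measurable_snd).stronglyMeasurable
  exact this.measurable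

theorem value_of_le (M : MarkovGame S A) {H h : ℕ} (π ν : Policy S A) (hh : H ≤ h) (x : S) :
    value M H π ν h x = 0 := by
  have : IsEmpty (Fin (H - h)) := by rw [Nat.sub_eq_zero_of_le hh]; infer_instance
  simp [value]

theorem measurable_misfit (M : MarkovGame S A) (h : ℕ) {f : Obs S A → ℝ} (hf : Measurable f) :
    Measurable (misfit M h f) := by
  have := StronglyMeasurable.integral_kernel_prod_right' (κ := M.outcome h)
    hf.stronglyMeasurable
  exact (this.measurable.comp measurable_fst).sub hf

theorem measurable_bellmanTest (M : MarkovGame S A) (H : ℕ) (π ν : Policy S A) (h : ℕ) :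
    Measurable (bellmanTest M H π ν h) := by
  have := (measurable_value M H π ν (h + 1)).comp
    (measurable_snd.comp measurable_snd : Measurable fun z : Obs S A => z.2.2)
  exact (measurable_fst.comp measurable_snd).add this

theorem integrable_of_ae_abs_le {Ω : Type*} [MeasurableSpace Ω] {μ : Measure Ω}
    [IsFiniteMeasure μ] {f : Ω → ℝ} (hf : Measurable f) {b : ℝ} (hb : ∀ᵐ ω ∂μ, |f ω| ≤ b) :
    Integrable f μ :=
  Integrable.of_bound hf.aestronglyMeasurable b hb

theorem abs_integral_le_of_ae {Ω : Type*} [MeasurableSpace Ω] {μ : Measure Ω}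
    [IsProbabilityMeasure μ] {f : Ω → ℝ} {b : ℝ} (hb : ∀ᵐ ω ∂μ, |f ω| ≤ b) :
    |∫ ω, f ω ∂μ| ≤ b := by
  simpa using norm_integral_le_of_norm_le_const (μ := μ) (f := f) (C := b) hb

/-- The Bellman equation. -/
theorem value_eq_integral_stepLaw (M : MarkovGame S A) {H h : ℕ} (π ν : Policy S A) (hh : h < H)
    (hr : ∀ j < H, ∀ y, |M.reward j y| ≤ 1) (x : S) :
    value M H π ν h x = ∫ z, bellmanTest M H π ν h z ∂(stepLaw M π ν h x) := by
  obtain ⟨n, rfl⟩ : ∃ n, H = h + (n + 1) := ⟨H - h - 1, by omega⟩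
  have e1 : h + (n + 1) - h = n + 1 := by omega
  have e2 : h + (n + 1) - (h + 1) = n := by omega
  unfold bellmanTest value
  rw [e1, e2, integral_trajLaw_succ M π ν n h x (measurable_sum_reward _)]
  · refine integral_congr_ae (Filter.Eventually.of_forall fun z => ?_)
    have hi : Integrable (fun τ : Fin n → Obs S A => ∑ i, (τ i).2.1)
        (trajLaw M π ν n (h + 1) z.2.2) := by
      refine integrable_of_ae_abs_le (measurable_sum_reward _) (b := n) ?_
      filter_upwards [ae_trajLaw_reward_le M π ν n (h + 1) z.2.2
        fun j hj => hr j (by omega)] with τ hτ using abs_sum_reward_le hτ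
    simp only [Fin.sum_univ_succ, Fin.cons_zero, Fin.cons_succ]
    rw [integral_add (integrable_const _) hi]
    simp
  · refine integrable_of_ae_abs_le (measurable_sum_reward _) (b := (n + 1 : ℕ)) ?_
    filter_upwards [ae_trajLaw_reward_le M π ν (n + 1) h x
      fun j hj => hr j (by omega)] with τ hτ using abs_sum_reward_le hτ

theorem abs_misfit_le (M : MarkovGame S A) (h : ℕ) {f : Obs S A → ℝ} {b : ℝ} {z : Obs S A}
    (hM : ∀ᵐ y ∂(M.outcome h z.1), |f (z.1, y)| ≤ b) (hz : |f z| ≤ b) :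
    |misfit M h f z| ≤ 2 * b := by
  have h1 := abs_integral_le_of_ae hM
  unfold misfit
  have := abs_sub (∫ y, f (z.1, y) ∂(M.outcome h z.1)) (f z)
  linarith

theorem abs_bellmanTest_le (M : MarkovGame S A) {H : ℕ} {π ν : Policy S A} {h : ℕ}
    (hV : ∀ h x, |value M H π ν h x| ≤ 1) {z : Obs S A} (hz : |z.2.1| ≤ 1) :
    |bellmanTest M H π ν h z| ≤ 2 := by
  have := abs_add_le z.2.1 (value M H π ν (h + 1) z.2.2)
  have := hV (h + 1) z.2.2
  unfold bellmanTest
  linarith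

theorem abs_misfit_bellmanTest_le (M : MarkovGame S A) {H : ℕ} {π ν : Policy S A} {h : ℕ}
    (hr : ∀ y, |M.reward h y| ≤ 1) (hV : ∀ h x, |value M H π ν h x| ≤ 1) {z : Obs S A}
    (hz : |z.2.1| ≤ 1) : |misfit M h (bellmanTest M H π ν h) z| ≤ 4 := by
  refine (abs_misfit_le M h (b := 2) ?_ (abs_bellmanTest_le M hV hz)).trans (by norm_num)
  filter_upwards [M.ae_outcome_reward h z.1] with y hy
  exact abs_bellmanTest_le M hV (by simpa [hy] using hr z.1)

/-- The expected misfit after one step of the true game. -/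
theorem integral_stepLaw_misfit (M Mtrue : MarkovGame S A) (π ν : Policy S A) (h : ℕ) (x : S)
    {f : Obs S A → ℝ} {b : ℝ} (hf : Measurable f)
    (hM : ∀ q, ∀ᵐ y ∂(M.outcome h q), |f (q, y)| ≤ b)
    (hT : ∀ q, ∀ᵐ y ∂(Mtrue.outcome h q), |f (q, y)| ≤ b) :
    ∫ z, misfit M h f z ∂(stepLaw Mtrue π ν h x) =
      ∫ z, f z ∂(stepLaw M π ν h x) - ∫ z, f z ∂(stepLaw Mtrue π ν h x) := by
  have hset : MeasurableSet {z | |f z| ≤ b} := measurableSet_le hf.abs measurable_const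
  have hm : Measurable fun q => ∫ y, f (q, y) ∂(M.outcome h q) :=
    (StronglyMeasurable.integral_kernel_prod_right' (κ := M.outcome h)
      hf.stronglyMeasurable).measurable
  have hi : Integrable (fun z : Obs S A => ∫ y, f (z.1, y) ∂(M.outcome h z.1))
      (stepLaw Mtrue π ν h x) :=
    integrable_of_ae_abs_le (hm.comp measurable_fst)
      (Filter.Eventually.of_forall fun z => abs_integral_le_of_ae (hM z.1))
  unfold misfit
  rw [integral_sub hi (integrable_of_ae_abs_le hf (ae_stepLaw Mtrue π ν h x hset hT)),
    integral_stepLaw Mtrue π ν h x hi,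
    integral_stepLaw M π ν h x (integrable_of_ae_abs_le hf (ae_stepLaw M π ν h x hset hM))]
  simp

theorem integral_trajLaw_succ_head (M : MarkovGame S A) (π ν : Policy S A) (n h : ℕ) (x : S)
    {f : Obs S A → ℝ} (hf : Measurable f) {b : ℝ} (hb : ∀ᵐ z ∂(stepLaw M π ν h x), |f z| ≤ b) :
    ∫ τ, f (τ 0) ∂(trajLaw M π ν (n + 1) h x) = ∫ z, f z ∂(stepLaw M π ν h x) := by
  have hm : Measurable fun τ : Fin (n + 1) → Obs S A => f (τ 0) :=
    hf.comp (measurable_pi_apply 0)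
  rw [integral_trajLaw_succ M π ν n h x hm]
  · simp
  · refine integrable_of_ae_abs_le hm (b := b) (ae_trajLaw_succ M π ν n h x
      (measurableSet_le hm.abs measurable_const) ?_)
    filter_upwards [hb] with z hz
    exact Filter.Eventually.of_forall fun τ => by simpa using hz

theorem integral_trajLaw_succ_tail (M : MarkovGame S A) (π ν : Policy S A) (n h : ℕ) (x : S)
    {f : Obs S A → ℝ} (hf : Measurable f) (i : Fin n) {b : ℝ}
    (hb : ∀ x, ∀ᵐ z ∂(stepLaw M π ν (h + 1 + i) x), |f z| ≤ b) :
    ∫ τ, f (τ i.succ) ∂(trajLaw M π ν (n + 1) h x) =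
      ∫ z, ∫ τ, f (τ i) ∂(trajLaw M π ν n (h + 1) z.2.2) ∂(stepLaw M π ν h x) := by
  have hm : Measurable fun τ : Fin (n + 1) → Obs S A => f (τ i.succ) :=
    hf.comp (measurable_pi_apply _)
  rw [integral_trajLaw_succ M π ν n h x hm]
  · simp
  · refine integrable_of_ae_abs_le hm (b := b) ?_
    -- The bound is available at the single step `h + 1 + i`, so the predicate is made vacuous at
    -- all others.
    have := ae_trajLaw M π ν (P := fun j z => j = h + 1 + i → |f z| ≤ b) (fun j => by
        by_cases hj : j = h + 1 + i
        · simpa [hj] using measurableSet_le hf.abs measurable_const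
        · simp [hj]) (n + 1) h x (fun j _ _ x => by
        by_cases hj : j = h + 1 + i
        · subst hj; simpa using hb x
        · simp [hj])
    filter_upwards [this] with τ hτ
    exact hτ i.succ (by simp; omega)

theorem ae_abs_misfit_le (M Mtrue : MarkovGame S A) (π ν : Policy S A) (h : ℕ) (x : S)
    {f : Obs S A → ℝ} {b : ℝ} (hf : Measurable f)
    (hM : ∀ q, ∀ᵐ y ∂(M.outcome h q), |f (q, y)| ≤ b)
    (hT : ∀ q, ∀ᵐ y ∂(Mtrue.outcome h q), |f (q, y)| ≤ b) :
    ∀ᵐ z ∂(stepLaw Mtrue π ν h x), |misfit M h f z| ≤ 2 * b := by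
  refine ae_stepLaw Mtrue π ν h x
    (measurableSet_le (measurable_misfit M h hf).abs measurable_const) fun q => ?_
  filter_upwards [hT q] with y hy
  exact abs_misfit_le M h (hM q) hy

/-- The decomposition of the difference of the values of a model and of the true game into the
expected misfits of the model along trajectories of the true game. -/
theorem sum_integral_misfit_bellmanTest (M Mtrue : MarkovGame S A) {H : ℕ} (π ν : Policy S A)
    (hrM : ∀ j < H, ∀ y, |M.reward j y| ≤ 1) (hrT : ∀ j < H, ∀ y, |Mtrue.reward j y| ≤ 1)
    (hVM : ∀ h x, |value M H π ν h x| ≤ 1) (hVT : ∀ h x, |value Mtrue H π ν h x| ≤ 1)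
    (n h : ℕ) (hn : h + n = H) (x : S) :
    ∑ i : Fin n, ∫ τ, misfit M (h + i) (bellmanTest M H π ν (h + i)) (τ i)
        ∂(trajLaw Mtrue π ν n h x) = value M H π ν h x - value Mtrue H π ν h x := by
  have hM : ∀ j < H, ∀ q, ∀ᵐ y ∂(M.outcome j q), |bellmanTest M H π ν j (q, y)| ≤ 2 := by
    intro j hj q
    filter_upwards [M.ae_outcome_reward j q] with y hy
    exact abs_bellmanTest_le M hVM (by simpa [hy] using hrM j hj q)
  have hT : ∀ j < H, ∀ q, ∀ᵐ y ∂(Mtrue.outcome j q), |bellmanTest M H π ν j (q, y)| ≤ 2 := by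
    intro j hj q
    filter_upwards [Mtrue.ae_outcome_reward j q] with y hy
    exact abs_bellmanTest_le M hVM (by simpa [hy] using hrT j hj q)
  have hmis : ∀ j < H, ∀ x, ∀ᵐ z ∂(stepLaw Mtrue π ν j x),
      |misfit M j (bellmanTest M H π ν j) z| ≤ 2 * 2 := fun j hj x =>
    ae_abs_misfit_le M Mtrue π ν j x (measurable_bellmanTest M H π ν j) (hM j hj) (hT j hj)
  induction n generalizing h x with
  | zero => simp [value_of_le M π ν (show H ≤ h by omega),
      value_of_le Mtrue π ν (show H ≤ h by omega)]
  | succ n ih =>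
    have hh : h < H := by omega
    have hmeas : ∀ j, Measurable (misfit M j (bellmanTest M H π ν j)) := fun j =>
      measurable_misfit M j (measurable_bellmanTest M H π ν j)
    rw [Fin.sum_univ_succ]
    simp only [Fin.val_zero, add_zero, Fin.val_succ]
    rw [integral_trajLaw_succ_head Mtrue π ν n h x (hmeas h) (hmis h hh x),
      integral_stepLaw_misfit M Mtrue π ν h x (measurable_bellmanTest M H π ν h) (hM h hh)
        (hT h hh), ← value_eq_integral_stepLaw M π ν hh hrM x]
    have e : ∀ i : Fin n, h + (↑i + 1) = h + 1 + i := fun i => by omega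
    simp only [e]
    have htail : ∀ i : Fin n, ∫ τ, misfit M (h + 1 + i) (bellmanTest M H π ν (h + 1 + i))
          (τ i.succ) ∂(trajLaw Mtrue π ν (n + 1) h x) =
        ∫ z, ∫ τ, misfit M (h + 1 + i) (bellmanTest M H π ν (h + 1 + i)) (τ i)
          ∂(trajLaw Mtrue π ν n (h + 1) z.2.2) ∂(stepLaw Mtrue π ν h x) := fun i =>
      integral_trajLaw_succ_tail Mtrue π ν n h x (hmeas _) i (hmis _ (by omega))
    simp only [htail]
    rw [← integral_finsetSum]
    -- The integral of the model's $V_{h+1}$ under the true step law occurs in the first misfit and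
    -- in the tail with opposite signs. After it cancels, the true Bellman equation remains.
    · simp only [ih (h + 1) (by omega)]
      have iv : ∀ N : MarkovGame S A, (∀ h x, |value N H π ν h x| ≤ 1) →
          Integrable (fun z : Obs S A => value N H π ν (h + 1) z.2.2) (stepLaw Mtrue π ν h x) :=
        fun N hN => integrable_of_ae_abs_le
          ((measurable_value N H π ν (h + 1)).comp (measurable_snd.comp measurable_snd))
          (Filter.Eventually.of_forall fun z => hN (h + 1) z.2.2)
      have ir : Integrable (fun z : Obs S A => z.2.1) (stepLaw Mtrue π ν h x) :=
        integrable_of_ae_abs_le (measurable_fst.comp measurable_snd)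
          (ae_stepLaw_reward_le Mtrue π ν h x (hrT h hh))
      rw [value_eq_integral_stepLaw Mtrue π ν hh hrT x]
      unfold bellmanTest
      rw [integral_add ir (iv M hVM), integral_add ir (iv Mtrue hVT),
        integral_sub (iv M hVM) (iv Mtrue hVT)]
      ring
    · intro i _
      have hm : StronglyMeasurable fun y => ∫ τ, misfit M (h + 1 + i)
          (bellmanTest M H π ν (h + 1 + i)) (τ i) ∂(trajLaw Mtrue π ν n (h + 1) y) :=
        StronglyMeasurable.integral_kernel_prod_right' (κ := trajLaw Mtrue π ν n (h + 1))
          (f := fun q : S × (Fin n → Obs S A) => misfit M (h + 1 + i)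
            (bellmanTest M H π ν (h + 1 + i)) (q.2 i))
          ((hmeas _).comp ((measurable_pi_apply i).comp measurable_snd)).stronglyMeasurable
      refine integrable_of_ae_abs_le
        (hm.measurable.comp (measurable_snd.comp measurable_snd)) (b := 2 * 2)
        (Filter.Eventually.of_forall fun z => abs_integral_le_of_ae ?_)
      have := ae_trajLaw Mtrue π ν (P := fun j z => |misfit M j (bellmanTest M H π ν j) z| ≤ 2 * 2)
        (fun j => measurableSet_le (hmeas j).abs measurable_const) n (h + 1) z.2.2
        (fun j _ hj x => hmis j (by omega) x)
      filter_upwards [this] with τ hτ using hτ i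

theorem sum_bellmanError (M Mtrue : MarkovGame S A) {H : ℕ} (π ν : Policy S A)
    (hrM : ∀ j < H, ∀ y, |M.reward j y| ≤ 1) (hrT : ∀ j < H, ∀ y, |Mtrue.reward j y| ≤ 1)
    (hVM : ∀ h x, |value M H π ν h x| ≤ 1) (hVT : ∀ h x, |value Mtrue H π ν h x| ≤ 1) (x : S) :
    ∑ h : Fin H, bellmanError Mtrue M H x π ν h =
      value M H π ν 0 x - value Mtrue H π ν 0 x := by
  simpa [bellmanError] using
    sum_integral_misfit_bellmanTest M Mtrue π ν hrM hrT hVM hVT H 0 (by simp) x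

/-- Given the current state and actions, the model predicts exactly the conditional mean of the test
function. This is why elimination keeps the true model. -/
theorem integral_trajLaw_misfit_self (M : MarkovGame S A) (π ν : Policy S A) {f : Obs S A → ℝ}
    {b : ℝ} (hf : Measurable f) (hb : ∀ z, |f z| ≤ b) (n h : ℕ) (x : S) (i : Fin n) :
    ∫ τ, misfit M (h + i) f (τ i) ∂(trajLaw M π ν n h x) = 0 := by
  have hmis : ∀ j x, ∀ᵐ z ∂(stepLaw M π ν j x), |misfit M j f z| ≤ 2 * b := fun j x =>
    ae_abs_misfit_le M M π ν j x hf (fun q => Filter.Eventually.of_forall fun y => hb _)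
      (fun q => Filter.Eventually.of_forall fun y => hb _)
  induction n generalizing h x with
  | zero => exact i.elim0
  | succ n ih =>
    refine Fin.cases ?_ (fun i => ?_) i
    · simp only [Fin.val_zero, add_zero]
      rw [integral_trajLaw_succ_head M π ν n h x (measurable_misfit M h hf) (hmis h x),
        integral_stepLaw_misfit M M π ν h x hf (fun q => Filter.Eventually.of_forall fun y => hb _)
          (fun q => Filter.Eventually.of_forall fun y => hb _), sub_self]
    · have e : h + (i.succ : ℕ) = h + 1 + i := by simp; omega
      rw [e, integral_trajLaw_succ_tail M π ν n h x (measurable_misfit M _ hf) i (hmis _)]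
      simp [ih (h + 1)]

end Trajectories

/-- **Hoeffding's inequality** for the empirical mean of `n` independent samples. -/
theorem measureReal_empMean_sub_gt_le {Ω : Type*} [MeasurableSpace Ω] (μ : Measure Ω)
    [IsProbabilityMeasure μ] {f : Ω → ℝ} (hf : Measurable f) {b : ℝ} (hb : 0 < b)
    (hfb : ∀ᵐ ω ∂μ, |f ω| ≤ b) {n : ℕ} (hn : 0 < n) {t : ℝ} (ht : 0 ≤ t) :
    (Measure.pi fun _ : Fin n => μ).real
        {D | t < |(n : ℝ)⁻¹ * ∑ j, f (D j) - ∫ ω, f ω ∂μ|} ≤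
      2 * Real.exp (-(n * t ^ 2 / (2 * b ^ 2))) := by
  have hn' : (0 : ℝ) < n := by exact_mod_cast hn
  -- One-sided bound, applied below to `f` and to `-f`. A variable with values in $[-b,b]$ is
  -- sub-Gaussian with parameter $b^2$.
  have key : ∀ F : Ω → ℝ, Measurable F → (∀ᵐ ω ∂μ, |F ω| ≤ b) →
      (Measure.pi fun _ : Fin n => μ).real {D | n * t ≤ ∑ j, (F (D j) - ∫ ω, F ω ∂μ)} ≤
        Real.exp (-(n * t ^ 2 / (2 * b ^ 2))) := by
    intro F hF hFb
    have hX : HasSubgaussianMGF (fun ω => F ω - ∫ ω, F ω ∂μ) ((‖b - -b‖₊ / 2) ^ 2) μ :=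
      hasSubgaussianMGF_of_mem_Icc hF.aemeasurable
        (by filter_upwards [hFb] with ω hω using abs_le.1 hω)
    have hind : iIndepFun (fun (i : Fin n) (D : Fin n → Ω) => F (D i) - ∫ ω, F ω ∂μ)
        (Measure.pi fun _ : Fin n => μ) :=
      iIndepFun_pi (Ω := fun _ : Fin n => Ω) (μ := fun _ => μ) (X := fun _ (ω : Ω) => F ω - ∫ ω, F ω ∂μ)
        fun _ => (hF.sub_const _).aemeasurable
    have hsub : ∀ i ∈ (Finset.univ : Finset (Fin n)),
        HasSubgaussianMGF (fun D : Fin n → Ω => F (D i) - ∫ ω, F ω ∂μ) ((‖b - -b‖₊ / 2) ^ 2)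
          (Measure.pi fun _ : Fin n => μ) := by
      intro i _
      have hmap : (Measure.pi fun _ : Fin n => μ).map (Function.eval i) = μ := by
        simpa using (measurePreserving_eval (fun _ : Fin n => μ) i).map_eq
      refine HasSubgaussianMGF.of_map (Y := fun D : Fin n → Ω => D i)
        (X := fun ω : Ω => F ω - ∫ ω, F ω ∂μ) (measurable_pi_apply i).aemeasurable ?_
      rw [hmap]
      exact hX
    refine (HasSubgaussianMGF.measure_sum_ge_le_of_iIndepFun hind hsub
      (ε := n * t) (by positivity)).trans_eq ?_
    congr 1
    have hc : (((‖b - -b‖₊ / 2) ^ 2 : NNReal) : ℝ) = b ^ 2 := by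
      push_cast
      rw [Real.norm_of_nonneg (by linarith)]
      ring
    rw [NNReal.coe_sum, Finset.sum_const, Finset.card_univ, Fintype.card_fin, nsmul_eq_mul, hc]
    field_simp
  have hsub : {D : Fin n → Ω | t < |(n : ℝ)⁻¹ * ∑ j, f (D j) - ∫ ω, f ω ∂μ|} ⊆
      {D | n * t ≤ ∑ j, (f (D j) - ∫ ω, f ω ∂μ)} ∪
        {D | n * t ≤ ∑ j, (-f (D j) - ∫ ω, -f ω ∂μ)} := by
    intro D hD
    have e : (n : ℝ)⁻¹ * ∑ j, f (D j) - ∫ ω, f ω ∂μ =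
        (n : ℝ)⁻¹ * (∑ j, f (D j) - n * ∫ ω, f ω ∂μ) := by field_simp
    have hD' : t < |(n : ℝ)⁻¹ * ∑ j, f (D j) - ∫ ω, f ω ∂μ| := hD
    rw [e, abs_mul, abs_of_pos (inv_pos.2 hn'), ← div_eq_inv_mul, lt_div_iff₀ hn', mul_comm] at hD'
    rcases lt_abs.1 hD' with h | h
    · left
      simp only [Set.mem_ofPred_eq, Finset.sum_sub_distrib, Finset.sum_const, Finset.card_univ,
        Fintype.card_fin, nsmul_eq_mul]
      linarith
    · right
      simp only [Set.mem_ofPred_eq, Finset.sum_sub_distrib, Finset.sum_const, Finset.card_univ,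
        Fintype.card_fin, nsmul_eq_mul, integral_neg, Finset.sum_neg_distrib]
      linarith
  have h1 := key f hf hfb
  have h2 := key (fun ω => -f ω) hf.neg (by simpa using hfb)
  calc _ ≤ _ := measureReal_mono hsub
    _ ≤ _ := measureReal_union_le _ _
    _ ≤ _ := by linarith

/-! ### Volume argument: cutting ellipsoids by slabs. -/

section Ellipsoid

open Matrix

variable {d : ℕ}

theorem dotProduct_vecMulVec_mulVec (u x : Fin d → ℝ) :
    x ⬝ᵥ vecMulVec u u *ᵥ x = (u ⬝ᵥ x) ^ 2 := by
  rw [vecMulVec_mulVec]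
  simp [dotProduct_comm x u, sq]

/-- The Cauchy–Schwarz inequality for the quadratic form of `A` and that of `A⁻¹`. -/
theorem sq_dotProduct_le_inv {A : Matrix (Fin d) (Fin d) ℝ} (hA : A.PosDef) (u v : Fin d → ℝ) :
    (u ⬝ᵥ v) ^ 2 ≤ (u ⬝ᵥ A⁻¹ *ᵥ u) * (v ⬝ᵥ A *ᵥ v) := by
  have hu : IsUnit A.det := (Matrix.isUnit_iff_isUnit_det A).1 hA.isUnit
  set w := A⁻¹ *ᵥ u with hw
  have hAw : A *ᵥ w = u := by rw [hw, mulVec_mulVec, mul_nonsing_inv _ hu, one_mulVec]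
  have hsymm : ∀ a b : Fin d → ℝ, a ⬝ᵥ A *ᵥ b = b ⬝ᵥ A *ᵥ a := fun a b => by
    have ht : Aᵀ = A := by
      rw [← conjTranspose_eq_transpose_of_trivial]; exact hA.isHermitian
    rw [dotProduct_mulVec, ← mulVec_transpose, ht, dotProduct_comm]
  -- The form of `A` at `A⁻¹ u + t v` is a nonnegative quadratic polynomial in `t`; the claim is
  -- that its discriminant is at most zero.
  have hq : ∀ t : ℝ, 0 ≤ (v ⬝ᵥ A *ᵥ v) * (t * t) + (2 * (u ⬝ᵥ v)) * t + u ⬝ᵥ w := by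
    intro t
    have h0 := hA.posSemidef.dotProduct_mulVec_nonneg (w + t • v)
    have h1 : v ⬝ᵥ A *ᵥ w = u ⬝ᵥ v := by rw [hAw, dotProduct_comm]
    have h2 : w ⬝ᵥ A *ᵥ v = u ⬝ᵥ v := by rw [hsymm, h1]
    have h3 : w ⬝ᵥ A *ᵥ w = u ⬝ᵥ w := by rw [hAw, dotProduct_comm]
    simp only [star_trivial, mulVec_add, mulVec_smul, dotProduct_add, add_dotProduct,
      dotProduct_smul, smul_dotProduct, smul_eq_mul, h1, h2, h3] at h0
    linarith
  have := discrim_le_zero hq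
  rw [discrim] at this
  nlinarith

/-- Evaluated at a unit eigenvector, the form is the eigenvalue, so the product of the `d`
eigenvalues is at most `lam ^ d`. -/
theorem det_le_pow_of_forall_le {A : Matrix (Fin d) (Fin d) ℝ} (hA : A.PosDef) {lam : ℝ}
    (h : ∀ x, x ⬝ᵥ A *ᵥ x ≤ lam * (x ⬝ᵥ x)) : A.det ≤ lam ^ d := by
  rw [hA.isHermitian.det_eq_prod_eigenvalues]
  have hle : ∀ i, hA.isHermitian.eigenvalues i ≤ lam := by
    intro i
    have h1 := hA.isHermitian.eigenvalues_eq i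
    have h2 := h (hA.isHermitian.eigenvectorBasis i)
    have h3 : (hA.isHermitian.eigenvectorBasis i : Fin d → ℝ) ⬝ᵥ
        (hA.isHermitian.eigenvectorBasis i : Fin d → ℝ) = 1 := by
      have := EuclideanSpace.inner_eq_star_dotProduct (𝕜 := ℝ)
        (hA.isHermitian.eigenvectorBasis i) (hA.isHermitian.eigenvectorBasis i)
      rw [real_inner_self_eq_norm_sq, hA.isHermitian.eigenvectorBasis.orthonormal.1 i] at this
      simpa using this.symm
    rw [h3, mul_one] at h2
    rw [h1]
    simpa using h2
  calc _ ≤ ∏ _i : Fin d, lam :=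
        Finset.prod_le_prod (fun i _ => (hA.eigenvalues_pos i).le) fun i _ => hle i
    _ = lam ^ d := by simp

/-- The ellipsoid `{v | vᵀ A v ≤ 1}` contains the vectors indexed by `s` and the
ball of radius `lam ^ (-1 / 2)`, and its volume is smaller than that of the unit ball by at
least a factor `exp c`. -/
def HasEllipsoid {ι : Type*} (V : ι → Fin d → ℝ) (lam : ℝ) (s : Finset ι) (c : ℕ) : Prop :=
  ∃ A : Matrix (Fin d) (Fin d) ℝ, A.PosDef ∧ Real.exp (2 * c) ≤ A.det ∧
    (∀ x, x ⬝ᵥ A *ᵥ x ≤ lam * (x ⬝ᵥ x)) ∧ ∀ m ∈ s, V m ⬝ᵥ A *ᵥ V m ≤ 1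

variable {ι : Type*} {V : ι → Fin d → ℝ} {lam : ℝ} {s s' : Finset ι} {c : ℕ}

theorem HasEllipsoid.mono (h : HasEllipsoid V lam s c) (hs : s' ⊆ s) :
    HasEllipsoid V lam s' c := by
  obtain ⟨A, h1, h2, h3, h4⟩ := h
  exact ⟨A, h1, h2, h3, fun m hm => h4 m (hs hm)⟩

theorem hasEllipsoid_zero (hlam : 1 ≤ lam) (hV : ∀ m ∈ s, V m ⬝ᵥ V m ≤ 1) :
    HasEllipsoid V lam s 0 := by
  refine ⟨1, Matrix.PosDef.one, by simp, fun x => ?_, fun m hm => by simpa using hV m hm⟩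
  have : 0 ≤ x ⬝ᵥ x := by simpa using dotProduct_star_self_nonneg x
  simpa using le_mul_of_one_le_left this hlam

/-- Each cut multiplies the determinant by at least $e^2$, while the inner ball keeps it bounded;
this limits the number of cuts. -/
theorem HasEllipsoid.exp_le (h : HasEllipsoid V lam s c) : Real.exp (2 * c) ≤ lam ^ d := by
  obtain ⟨A, h1, h2, h3, -⟩ := h
  exact h2.trans (det_le_pow_of_forall_le h1 h3)

theorem dotProduct_sq_le (u x : Fin d → ℝ) : (u ⬝ᵥ x) ^ 2 ≤ (u ⬝ᵥ u) * (x ⬝ᵥ x) := by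
  simpa [dotProduct, sq] using Finset.sum_mul_sq_le_sq_mul_sq Finset.univ u x

/-- Cutting the ellipsoid by a thin slab. -/
theorem HasEllipsoid.cut (h : HasEllipsoid V lam s c) (hs : s' ⊆ s) (hd : 0 < d)
    {u : Fin d → ℝ} {r : ℝ} (hr : 0 < r) (hu : u ⬝ᵥ u ≤ lam * r ^ 2)
    (hbig : ∃ m ∈ s, 22 * d * r ^ 2 ≤ (u ⬝ᵥ V m) ^ 2)
    (hsmall : ∀ m ∈ s', (u ⬝ᵥ V m) ^ 2 ≤ r ^ 2) : HasEllipsoid V lam s' (c + 1) := by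
  obtain ⟨A, hA, hdet, hle, hin⟩ := h
  have hd' : (0 : ℝ) < d := by exact_mod_cast hd
  -- The new form is the convex combination, with weights `a = d/(d+1)` and `b = 1/(d+1)`, of the
  -- old form and the slab form $(u\cdot x)^2/r^2$. Any bound shared by both forms is inherited, so
  -- no minimum-volume ellipsoid is needed. With these weights $a^{-d}=(1+1/d)^d\le e$ and
  -- $b/a=1/d$.
  obtain ⟨a, b, ha, hb, hab, hba⟩ : ∃ a b : ℝ, 0 < a ∧ 0 < b ∧ a + b = 1 ∧ b / a = 1 / d :=
    ⟨d / (d + 1), 1 / (d + 1), by positivity, by positivity, by field_simp, by field_simp⟩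
  have had : a⁻¹ = 1 + (d : ℝ)⁻¹ := by
    have : b = a / d := by field_simp at hba; field_simp; linarith
    rw [this] at hab
    field_simp at hab ⊢
    linarith
  have hr2 : 0 < r ^ 2 := by positivity
  have hquad : ∀ x, x ⬝ᵥ (a • A + (b / r ^ 2) • vecMulVec u u) *ᵥ x =
      a * (x ⬝ᵥ A *ᵥ x) + b * ((u ⬝ᵥ x) ^ 2 / r ^ 2) := by
    intro x
    rw [add_mulVec, smul_mulVec, smul_mulVec, dotProduct_add, dotProduct_smul, dotProduct_smul,
      dotProduct_vecMulVec_mulVec, smul_eq_mul, smul_eq_mul]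
    ring
  have haA : (a • A).PosDef := hA.smul ha
  refine ⟨a • A + (b / r ^ 2) • vecMulVec u u, ?_, ?_, ?_, ?_⟩
  · have := Matrix.posSemidef_vecMulVec_self_star u
    rw [star_trivial] at this
    exact haA.add_posSemidef (this.smul (by positivity))
  · obtain ⟨m, hm, hm22⟩ := hbig
    have hdetA : 0 < A.det := hA.det_pos
    have hunit : IsUnit (a • A).det := (Matrix.isUnit_iff_isUnit_det _).1 haA.isUnit
    have e : (b / r ^ 2) • vecMulVec u u =
        replicateCol Unit ((b / r ^ 2) • u) * replicateRow Unit u := by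
      rw [← vecMulVec_eq, smul_vecMulVec]
    -- Matrix determinant lemma for a rank-one perturbation of `a • A`.
    have hdet1 : (a • A + (b / r ^ 2) • vecMulVec u u).det =
        a ^ d * A.det * (1 + (b / a) * ((u ⬝ᵥ A⁻¹ *ᵥ u) / r ^ 2)) := by
      rw [e, det_add_replicateCol_mul_replicateRow hunit, det_smul, Fintype.card_fin]
      congr 1
      rw [det_unique]
      have hinv : (a • A)⁻¹ = a⁻¹ • A⁻¹ := by
        have := Matrix.inv_smul' (A := A) (Units.mk0 a ha.ne') ((Matrix.isUnit_iff_isUnit_det A).1 hA.isUnit)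
        simpa [Units.smul_def] using this
      rw [Matrix.add_apply, one_apply_eq, hinv, Matrix.mul_assoc]
      congr 1
      rw [← replicateCol_mulVec, replicateRow_mul_replicateCol_apply, smul_mulVec, mulVec_smul,
        dotProduct_smul, dotProduct_smul, smul_eq_mul, smul_eq_mul]
      field_simp
    -- The vector `V m` lies in the old ellipsoid and far outside the slab, which forces $u^\top
    -- A^{-1}u\ge 22\,d\,r^2$.
    have hcs := sq_dotProduct_le_inv hA u (V m)
    have hpos : 0 ≤ u ⬝ᵥ A⁻¹ *ᵥ u := by
      simpa using hA.inv.posSemidef.dotProduct_mulVec_nonneg u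
    have hVm := hin m hm
    have h22 : 22 * d ≤ (u ⬝ᵥ A⁻¹ *ᵥ u) / r ^ 2 := by
      rw [le_div_iff₀ hr2]
      nlinarith
    have h22' : 22 ≤ (b / a) * ((u ⬝ᵥ A⁻¹ *ᵥ u) / r ^ 2) := by
      rw [hba]
      calc (22 : ℝ) = 1 / d * (22 * d) := by field_simp
        _ ≤ _ := by gcongr
    -- The origin of 22: the loss $a^d\ge e^{-1}$ and the required gain $e^2$ together cost
    -- $e^3\approx 20.1$.
    have hexp : Real.exp 1 ^ 3 ≤ 22 := by
      have h1 := Real.exp_one_lt_d9.le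
      have h0 := (Real.exp_pos 1).le
      calc Real.exp 1 ^ 3 ≤ 2.7182818286 ^ 3 := by gcongr
        _ ≤ 22 := by norm_num
    have had' : a⁻¹ ^ d ≤ Real.exp 1 := by rw [had]; exact Real.one_add_inv_pow_le_exp
    have hapow : 1 ≤ a ^ d * Real.exp 1 := by
      rw [inv_pow] at had'
      rwa [inv_le_iff_one_le_mul₀' (by positivity)] at had'
    rw [hdet1]
    have e2 : Real.exp (2 * (c + 1 : ℕ)) = Real.exp (2 * c) * (Real.exp 1) ^ 2 := by
      rw [← Real.exp_nat_mul, ← Real.exp_add]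
      push_cast
      ring_nf
    rw [e2]
    have hE : Real.exp 1 ^ 2 ≤ a ^ d * 22 := by
      calc Real.exp 1 ^ 2 = 1 * Real.exp 1 ^ 2 := by ring
        _ ≤ (a ^ d * Real.exp 1) * Real.exp 1 ^ 2 := by gcongr
        _ = a ^ d * Real.exp 1 ^ 3 := by ring
        _ ≤ _ := by gcongr
    calc Real.exp (2 * c) * Real.exp 1 ^ 2 ≤ A.det * (a ^ d * 22) := by gcongr
      _ = a ^ d * A.det * 22 := by ring
      _ ≤ _ := by gcongr; linarith
  · intro x
    rw [hquad]
    have h1 := hle x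
    have hx : 0 ≤ x ⬝ᵥ x := by simpa using dotProduct_star_self_nonneg x
    have h2 : (u ⬝ᵥ x) ^ 2 / r ^ 2 ≤ lam * (x ⬝ᵥ x) := by
      rw [div_le_iff₀ hr2]
      have := dotProduct_sq_le u x
      nlinarith [mul_le_mul_of_nonneg_right hu hx]
    calc _ ≤ a * (lam * (x ⬝ᵥ x)) + b * (lam * (x ⬝ᵥ x)) := by gcongr
      _ = (a + b) * (lam * (x ⬝ᵥ x)) := by ring
      _ = lam * (x ⬝ᵥ x) := by rw [hab, one_mul]
  · intro m hm
    rw [hquad]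
    have h1 := hin m (hs hm)
    have h2 : (u ⬝ᵥ V m) ^ 2 / r ^ 2 ≤ 1 := by
      rw [div_le_one hr2]; exact hsmall m hm
    nlinarith [mul_le_mul_of_nonneg_left h1 ha.le, mul_le_mul_of_nonneg_left h2 hb.le]

end Ellipsoid

/-! ### Normalized factorizations from the witness rank. -/

section WitnessRank

/-- Only the products of norms are bounded by `β`. Multiplying `U` and dividing `V` by the largest
norm of a row of `V` puts `V` in the unit ball and bounds `U` by `β`. If no `b j` is positive, any
small enough scale works. -/
theorem exists_common_scale {I J : Type*} [Finite I] [Finite J] (a : I → ℝ) (b : J → ℝ)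
    {β : ℝ} (hβ : 0 < β) (hab : ∀ i j, a i * b j ≤ β) :
    ∃ R : ℝ, 0 < R ∧ (∀ j, b j ≤ R) ∧ ∀ i, a i * R ≤ β := by
  by_cases h0 : ∃ j, 0 < b j
  · obtain ⟨j₁, hj₁⟩ := h0
    have : Nonempty J := ⟨j₁⟩
    obtain ⟨j₀, hj₀⟩ := Finite.exists_max b
    exact ⟨b j₀, hj₁.trans_le (hj₀ j₁), hj₀, fun i => hab i j₀⟩
  · push Not at h0
    obtain ⟨K, hK⟩ := (Set.finite_range a).bddAbove
    have hK' : ∀ i, a i ≤ |K| := fun i => (hK ⟨i, rfl⟩).trans (le_abs_self K)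
    refine ⟨β / (|K| + 1), by positivity, fun j => (h0 j).trans (by positivity), fun i => ?_⟩
    rw [mul_div_assoc', div_le_iff₀ (by positivity)]
    nlinarith [hK' i]

theorem exists_factorization_of_boundedRank_le {I J : Type*} [Finite I] [Finite J]
    {B : Matrix I J ℝ} {β : ℝ} (hβ : 0 < β) {W : ℕ} (hB : boundedRank B β ≤ W) :
    ∃ d ≤ W, ∃ (U : I → Fin d → ℝ) (V : J → Fin d → ℝ), (∀ i j, B i j = U i ⬝ᵥ V j) ∧
      (∀ j, V j ⬝ᵥ V j ≤ 1) ∧ ∀ i, U i ⬝ᵥ U i ≤ β ^ 2 := by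
  -- Passing to the strict bound by `W + 1` allows an actual factorization to be extracted from the
  -- infimum.
  have hlt : boundedRank B β < ((W + 1 : ℕ) : ℕ∞) :=
    hB.trans_lt (by exact_mod_cast Nat.lt_succ_self W)
  rw [boundedRank, iInf_lt_iff] at hlt
  obtain ⟨d, hd⟩ := hlt
  rw [iInf_lt_iff] at hd
  obtain ⟨⟨U, V, hUV, hβUV⟩, hdW⟩ := hd
  have hdW' : d ≤ W := Nat.lt_succ_iff.1 (by exact_mod_cast hdW)
  obtain ⟨R, hR, hRV, hRU⟩ := exists_common_scale (fun i => ‖U i‖) (fun j => ‖V j‖) hβ hβUV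
  have hdot : ∀ x y : EuclideanSpace ℝ (Fin d), (x : Fin d → ℝ) ⬝ᵥ (y : Fin d → ℝ) =
      inner ℝ x y := fun x y => by
    rw [EuclideanSpace.inner_eq_star_dotProduct, star_trivial, dotProduct_comm]
  refine ⟨d, hdW', fun i => R • (U i : Fin d → ℝ), fun j => R⁻¹ • (V j : Fin d → ℝ), ?_, ?_, ?_⟩
  · intro i j
    rw [smul_dotProduct, dotProduct_smul, hdot, hUV, smul_smul, mul_inv_cancel₀ hR.ne', one_smul]
  · intro j
    rw [smul_dotProduct, dotProduct_smul, hdot, real_inner_self_eq_norm_sq]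
    have h1 : R⁻¹ * ‖V j‖ ≤ 1 := by rw [inv_mul_le_iff₀ hR, mul_one]; exact hRV j
    calc R⁻¹ • R⁻¹ • ‖V j‖ ^ 2 = (R⁻¹ * ‖V j‖) ^ 2 := by simp only [smul_eq_mul]; ring
      _ ≤ 1 := pow_le_one₀ (by positivity) h1
  · intro i
    rw [smul_dotProduct, dotProduct_smul, hdot, real_inner_self_eq_norm_sq]
    calc R • R • ‖U i‖ ^ 2 = (‖U i‖ * R) ^ 2 := by simp only [smul_eq_mul]; ring
      _ ≤ β ^ 2 := by gcongr; exact hRU i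

variable {S A ι γ : Type*} [MeasurableSpace S] [MeasurableSpace A] {𝓜 : ι → MarkovGame S A}
  {H : ℕ} {x₁ : S} {ε : ℝ}

theorem exists_factorization_of_witnessRank_eq [Finite ι] {Mtrue : MarkovGame S A}
    {P : Planner 𝓜 H x₁ ε} {g : γ → Obs S A → ℝ} {κ β : ℝ} (hβ : 0 < β) {W : ℕ}
    (hW : witnessRank Mtrue P g κ β = W) (h : Fin H) :
    ∃ d ≤ W, ∃ (U : ι × ι → Fin d → ℝ) (V : ι → Fin d → ℝ),
      (∀ m₁ m₂ m,
        κ * |bellmanError Mtrue (𝓜 m) H x₁ (P.pi m₁) (P.nu m₁ m₂) h| ≤ U (m₁, m₂) ⬝ᵥ V m ∧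
          U (m₁, m₂) ⬝ᵥ V m ≤
            witnessMisfit Mtrue (𝓜 m) H x₁ g (P.pi m₁) (P.nu m₁ m₂) h) ∧
      (∀ m, V m ⬝ᵥ V m ≤ 1) ∧ ∀ q, U q ⬝ᵥ U q ≤ β ^ 2 := by
  have hle : ⨅ B ∈ witnessMatrices Mtrue P g κ h, boundedRank B β ≤ W :=
    (le_iSup (fun h : Fin H => ⨅ B ∈ witnessMatrices Mtrue P g κ h, boundedRank B β) h).trans_eq hW
  have hlt := hle.trans_lt (show (W : ℕ∞) < ((W + 1 : ℕ) : ℕ∞) by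
    exact_mod_cast Nat.lt_succ_self W)
  rw [iInf_lt_iff] at hlt
  obtain ⟨B, hB⟩ := hlt
  rw [iInf_lt_iff] at hB
  obtain ⟨hBmem, hB⟩ := hB
  have hBW : boundedRank B β ≤ W := by
    rw [Nat.cast_add, Nat.cast_one] at hB
    exact Order.lt_add_one_iff_of_not_isMax (by simp) |>.1 hB
  obtain ⟨d, hd, U, V, h1, h2, h3⟩ := exists_factorization_of_boundedRank_le hβ hBW
  refine ⟨d, hd, U, V, fun m₁ m₂ m => ?_, h2, h3⟩
  rw [← h1]
  exact hBmem m₁ m₂ m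

end WitnessRank

/-! ### A single round: measurability, optimality at stopping, elimination. -/

section Rounds

variable {S A ι γ : Type*} [MeasurableSpace S] [MeasurableSpace A] {𝓜 : ι → MarkovGame S A}
  {H : ℕ} {x₁ : S} {ε : ℝ}

theorem measurable_empValue {n : ℕ} :
    Measurable (empValue : (Fin n → Fin H → Obs S A) → ℝ) := by
  unfold empValue
  fun_prop

theorem measurable_empBellmanError {n : ℕ} (M : MarkovGame S A) (π ν : Policy S A) (h : Fin H) :
    Measurable fun D : Fin n → Fin H → Obs S A => empBellmanError M π ν D h := by
  unfold empBellmanError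
  refine Measurable.const_mul (Finset.measurable_sum _ fun j _ => ?_) _
  exact (measurable_misfit M h (measurable_bellmanTest M H π ν h)).comp
    ((measurable_pi_apply h).comp (measurable_pi_apply j))

theorem measurable_empWitnessMisfit [Finite γ] {n : ℕ} (M : MarkovGame S A)
    {g : γ → Obs S A → ℝ} (hg : ∀ c, Measurable (g c)) (h : Fin H) :
    Measurable fun D : Fin n → Fin H → Obs S A => empWitnessMisfit M g D h := by
  unfold empWitnessMisfit
  refine Measurable.iSup fun c => Measurable.const_mul (Finset.measurable_sum _ fun j _ => ?_) _
  exact (measurable_misfit M h (hg c)).comp ((measurable_pi_apply h).comp (measurable_pi_apply j))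

theorem Planner.measurable_roundErr (P : Planner 𝓜 H x₁ ε) (s : Finset ι) {n₁ : ℕ} :
    Measurable fun D : Fin n₁ → Fin H → Obs S A => P.roundErr s D :=
  measurable_pi_lambda _ fun _ => measurable_pi_lambda _ fun h =>
    measurable_empBellmanError _ _ _ h

open Classical in
-- The filtered set depends only on a point of the finite discrete space `ι → Prop`, on which every
-- map is measurable.
theorem measurable_finset_filter {Ω : Type*} [MeasurableSpace Ω] [Finite ι] (s : Finset ι)
    {p : Ω → ι → Prop} (hp : ∀ m, MeasurableSet {ω | p ω m}) :
    @Measurable Ω (Finset ι) _ ⊤ fun ω => s.filter (p ω) := by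
  have h1 : Measurable fun ω => p ω := measurable_pi_lambda _ fun m => measurableSet_setOfPred.1 (hp m)
  have h2 : @Measurable (ι → Prop) (Finset ι) _ ⊤ fun q => s.filter q := by
    let _ : MeasurableSpace (Finset ι) := ⊤
    exact Measurable.of_discrete
  exact @Measurable.comp _ _ _ _ _ ⊤ _ _ h2 h1

theorem Planner.measurable_round [Finite ι] [Finite γ] (P : Planner 𝓜 H x₁ ε)
    {g : γ → Obs S A → ℝ} (hg : ∀ c, Measurable (g c)) (φ : ℝ) {n₁ n : ℕ} (s : Finset ι)
    (used : ℕ) : Measurable (P.round (n₁ := n₁) (n := n) g φ s used) := by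
  classical
  have herr : Measurable fun D : (Fin n₁ → Fin H → Obs S A) × (Fin n → Fin H → Obs S A) =>
      P.roundErr s D.1 := (P.measurable_roundErr s).comp measurable_fst
  unfold Planner.round
  refine Measurable.ite (MeasurableSet.const _) measurable_const ?_
  refine Measurable.ite ?_ measurable_const ?_
  · rw [Set.ofPred_forall]
    refine MeasurableSet.iInter fun i => measurableSet_le ?_ measurable_const
    exact ((measurable_empValue.comp measurable_fst).sub_const _).abs
  refine Measurable.ite ?_ ?_ measurable_const
  · simp only [Set.ofPred_exists]
    refine MeasurableSet.iUnion fun h => MeasurableSet.iUnion fun i =>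
      measurableSet_le measurable_const ?_
    exact ((measurable_pi_apply h).comp ((measurable_pi_apply i).comp herr)).abs
  · have hstep := (P.step_measurable s).comp herr
    have hfilter := measurable_finset_filter s
      (p := fun (D : (Fin n₁ → Fin H → Obs S A) × (Fin n → Fin H → Obs S A)) m =>
        empWitnessMisfit (𝓜 m) g D.2 (P.step s (P.roundErr s D.1)) ≤ φ) (fun m => ?_)
    · let _ : MeasurableSpace (Finset ι) := ⊤
      exact (measurable_from_top (f := fun t : Finset ι =>
        Status.running t (used + n₁ + n))).comp hfilter
    -- The selected step is itself random, so the event is split according to its finitely many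
    -- values.
    · have e : {D : (Fin n₁ → Fin H → Obs S A) × (Fin n → Fin H → Obs S A) |
          empWitnessMisfit (𝓜 m) g D.2 (P.step s (P.roundErr s D.1)) ≤ φ} =
          ⋃ h : Fin H, {D | P.step s (P.roundErr s D.1) = h} ∩
            {D | empWitnessMisfit (𝓜 m) g D.2 h ≤ φ} := by
        ext D; simp
      rw [e]
      refine MeasurableSet.iUnion fun h => MeasurableSet.inter ?_ ?_
      · exact hstep (measurableSet_singleton h)
      · exact measurableSet_le ((measurable_empWitnessMisfit (𝓜 m) hg h).comp measurable_snd)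
          measurable_const

/-- The samples of a round for which all empirical estimates are accurate. -/
def accurateSamples (Mtrue : MarkovGame S A) (P : Planner 𝓜 H x₁ ε) (g : γ → Obs S A → ℝ) (φ : ℝ)
    (n₁ n : ℕ) (s : Finset ι) : Set ((Fin n₁ → Fin H → Obs S A) × (Fin n → Fin H → Obs S A)) :=
  {D | |empValue D.1 - value Mtrue H (P.roundPi s) (P.roundNu s) 0 x₁| ≤ ε / 8 ∧
    (∀ i h, |P.roundErr s D.1 i h -
      bellmanError Mtrue (𝓜 (P.sel s i)) H x₁ (P.roundPi s) (P.roundNu s) h| ≤ ε / (8 * H)) ∧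
    ∀ m c (h : Fin H), |(n : ℝ)⁻¹ * ∑ j, misfit (𝓜 m) h (g c) (D.2 j h) -
      ∫ τ, misfit (𝓜 m) h (g c) (τ h)
        ∂(trajLaw Mtrue (P.roundPi s) (P.roundNu s) H 0 x₁)| ≤ φ}

section Values

variable {P : Planner 𝓜 H x₁ ε} {mstar : ι}

/-- Needed because an infimum of reals carries information only for sets bounded below. -/
theorem bddBelow_range_value (hV : ∀ m π ν h x, |value (𝓜 m) H π ν h x| ≤ 1) (m : ι)
    (π : Policy S A) : BddBelow (Set.range fun ν => value (𝓜 m) H π ν 0 x₁) :=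
  ⟨-1, by rintro _ ⟨ν, rfl⟩; exact (abs_le.1 (hV m π ν 0 x₁)).1⟩

theorem worstValue_eq_of_isBestResponse (hV : ∀ m π ν h x, |value (𝓜 m) H π ν h x| ≤ 1) {m : ι}
    {π ν : Policy S A} (hν : IsBestResponse (𝓜 m) H x₁ π ν) :
    worstValue (𝓜 m) H x₁ π = value (𝓜 m) H π ν 0 x₁ := by
  have : Nonempty (Policy S A) := ⟨ν⟩
  exact le_antisymm (ciInf_le (bddBelow_range_value hV m π) ν) (le_ciInf hν)

/-- With a Nash partner `ν₀` of `P.pi m`, any `π` is worth at most its value against `ν₀`, hence at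
most the equilibrium value. That value is at most the one against `P.nu m m`, because `ν₀` is itself
a best response. -/
theorem gameValue_le (hV : ∀ m π ν h x, |value (𝓜 m) H π ν h x| ≤ 1) (P : Planner 𝓜 H x₁ ε)
    (m : ι) : gameValue (𝓜 m) H x₁ ≤ value (𝓜 m) H (P.pi m) (P.nu m m) 0 x₁ := by
  obtain ⟨ν₀, h1, h2⟩ := P.pi_spec m
  have : Nonempty (Policy S A) := ⟨ν₀⟩
  refine ciSup_le fun π => ?_
  calc worstValue (𝓜 m) H x₁ π ≤ value (𝓜 m) H π ν₀ 0 x₁ :=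
        ciInf_le (bddBelow_range_value hV m π) ν₀
    _ ≤ value (𝓜 m) H (P.pi m) ν₀ 0 x₁ := h1 π
    _ ≤ _ := h2 _

/-- When the algorithm stops, its output is `ε`-optimal. -/
theorem gameValue_sub_worstValue_le (hV : ∀ m π ν h x, |value (𝓜 m) H π ν h x| ≤ 1)
    (P : Planner 𝓜 H x₁ ε) {s : Finset ι} (hs : mstar ∈ s) {v : ℝ}
    (hclose : ∀ i, |v - value (𝓜 (P.sel s i)) H (P.roundPi s) (P.roundNu s) 0 x₁| ≤ ε / 2) :
    gameValue (𝓜 mstar) H x₁ - worstValue (𝓜 mstar) H x₁ (P.pi (P.opt s)) ≤ ε := by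
  have h0 := abs_le.1 (hclose 0)
  have h1 := abs_le.1 (hclose 1)
  simp only [Planner.sel, Planner.roundPi, Planner.roundNu, if_true, one_ne_zero, if_false]
    at h0 h1
  -- The chain is $V^*\le V_{M_1}^{\pi^k,\nu^{M_1}}\le V_{M_1}^{\pi^k,\nu^k}\le v+\epsilon/2$ and
  -- $v-\epsilon/2\le V_{M_2}^{\pi^k,\nu^k}\le V_{M^*}^{\pi^k,\nu^{M^*}}$. The second inequality
  -- holds because $\nu^{M_1}$ is a best response in $M_1$.
  have hopt := P.opt_max s mstar hs
  have hpess := P.pess_min s mstar hs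
  have hbest := P.nu_spec (P.opt s) (P.opt s) (P.nu (P.opt s) (P.pess s))
  have hgame := gameValue_le hV P mstar
  rw [worstValue_eq_of_isBestResponse hV (P.nu_spec (P.opt s) mstar)]
  linarith [h0.1, h1.2]

end Values

/-- A round with accurate samples either stops with an `ε`-optimal policy, or keeps the true model
and eliminates all models with a large misfit at a step where one of the selected models has a
large Bellman error. -/
theorem Planner.round_of_mem_accurateSamples [Finite γ] [Nonempty γ] (P : Planner 𝓜 H x₁ ε)
    (hε : 0 < ε) (hr : ∀ m, ∀ h < H, ∀ y, |(𝓜 m).reward h y| ≤ 1)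
    (hV : ∀ m π ν h x, |value (𝓜 m) H π ν h x| ≤ 1)
    {g : γ → Obs S A → ℝ} (hg : ∀ c, Measurable (g c)) (hg1 : ∀ c z, |g c z| ≤ 1) {φ : ℝ}
    {n₁ n : ℕ} {mstar : ι} {s : Finset ι} (hs : mstar ∈ s) (used : ℕ)
    {D : (Fin n₁ → Fin H → Obs S A) × (Fin n → Fin H → Obs S A)}
    (hD : D ∈ accurateSamples (𝓜 mstar) P g φ n₁ n s) :
    (P.round g φ s used D = Status.output (P.opt s) (used + n₁) ∧
      gameValue (𝓜 mstar) H x₁ - worstValue (𝓜 mstar) H x₁ (P.pi (P.opt s)) ≤ ε) ∨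
    ∃ s' ⊆ s, mstar ∈ s' ∧ P.round g φ s used D = Status.running s' (used + n₁ + n) ∧
      ∃ h i, ε / (8 * H) ≤ |bellmanError (𝓜 mstar) (𝓜 (P.sel s i)) H x₁ (P.roundPi s)
          (P.roundNu s) h| ∧
        ∀ m ∈ s', witnessMisfit (𝓜 mstar) (𝓜 m) H x₁ g (P.roundPi s) (P.roundNu s) h ≤ 2 * φ := by
  classical
  obtain ⟨hD1, hD2, hD3⟩ := hD
  have hne : s.Nonempty := ⟨mstar, hs⟩
  unfold Planner.round
  rw [if_neg (not_not.2 hne)]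
  split_ifs with hclose herr
  · exact Or.inl ⟨rfl, gameValue_sub_worstValue_le hV P hs hclose⟩
  · right
    refine ⟨_, Finset.filter_subset _ _, ?_, rfl, ?_⟩
    -- The true model passes the test: its exact misfits vanish, so its empirical ones are at most
    -- `φ`.
    · refine Finset.mem_filter.2 ⟨hs, ciSup_le fun c => ?_⟩
      have h1 := (abs_le.1 (hD3 mstar c (P.step s (P.roundErr s D.1)))).2
      have h2 := integral_trajLaw_misfit_self (𝓜 mstar) (P.roundPi s) (P.roundNu s) (hg c)
        (hg1 c) H 0 x₁ (P.step s (P.roundErr s D.1))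
      rw [zero_add] at h2
      rw [h2, sub_zero] at h1
      exact h1
    · obtain ⟨i, hi⟩ := P.step_spec s (P.roundErr s D.1) herr
      refine ⟨P.step s (P.roundErr s D.1), i, ?_, fun m hm => ?_⟩
      · have h1 := hD2 i (P.step s (P.roundErr s D.1))
        have h2 := abs_sub_abs_le_abs_sub (P.roundErr s D.1 i (P.step s (P.roundErr s D.1)))
          (bellmanError (𝓜 mstar) (𝓜 (P.sel s i)) H x₁ (P.roundPi s)
          (P.roundNu s) (P.step s (P.roundErr s D.1)))
        have e : ε / (4 * H) = 2 * (ε / (8 * H)) := by ring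
        rw [e] at hi
        linarith
      -- Passing the test with tolerance `φ`, plus an estimation error of at most `φ`, gives `2 *
      -- φ`.
      · refine ciSup_le fun c => ?_
        have h1 := (abs_le.1 (hD3 m c (P.step s (P.roundErr s D.1)))).1
        have h2 := (Finset.mem_filter.1 hm).2
        have h3 := (le_ciSup (f := fun c => (n : ℝ)⁻¹ * ∑ j, misfit (𝓜 m)
          (P.step s (P.roundErr s D.1)) (g c) (D.2 j (P.step s (P.roundErr s D.1))))
          (Set.finite_range _).bddAbove c).trans h2
        linarith
  -- Failure is impossible. If all empirical Bellman errors were below $\epsilon/(4H)$, the exact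
  -- ones would be at most $3\epsilon/(8H)$ and the value error at most $3\epsilon/8$. With the
  -- error $\epsilon/8$ of the return, the stopping test would have succeeded.
  · exfalso
    push Not at hclose herr
    obtain ⟨i, hi⟩ := hclose
    have hH : 0 < H := Fin.pos (P.step s (P.roundErr s D.1))
    have hH' : (0 : ℝ) < H := by exact_mod_cast hH
    have hsum := sum_bellmanError (𝓜 (P.sel s i)) (𝓜 mstar) (P.roundPi s) (P.roundNu s)
      (hr _) (hr _) (hV _ _ _) (hV _ _ _) x₁
    have hlt : ∀ h, |bellmanError (𝓜 mstar) (𝓜 (P.sel s i)) H x₁ (P.roundPi s)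
        (P.roundNu s) h| ≤ 3 * ε / (8 * H) := by
      intro h
      have h1 := hD2 i h
      have h2 := abs_sub_abs_le_abs_sub (bellmanError (𝓜 mstar) (𝓜 (P.sel s i)) H x₁ (P.roundPi s)
          (P.roundNu s) h) (P.roundErr s D.1 i h)
      rw [abs_sub_comm] at h2
      have h3 := herr h i
      have e : ε / (4 * H) = 2 * (ε / (8 * H)) := by ring
      have e' : 3 * ε / (8 * H) = 3 * (ε / (8 * H)) := by ring
      rw [e] at h3
      rw [e']
      linarith
    have h4 : |value (𝓜 (P.sel s i)) H (P.roundPi s) (P.roundNu s) 0 x₁ -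
        value (𝓜 mstar) H (P.roundPi s) (P.roundNu s) 0 x₁| ≤ 3 * ε / 8 := by
      rw [← hsum]
      refine (Finset.abs_sum_le_sum_abs _ _).trans ((Finset.sum_le_sum fun h _ => hlt h).trans ?_)
      rw [Finset.sum_const, Finset.card_univ, Fintype.card_fin, nsmul_eq_mul]
      apply le_of_eq
      field_simp
    have h5 := abs_sub_le (empValue D.1) (value (𝓜 mstar) H (P.roundPi s) (P.roundNu s) 0 x₁)
      (value (𝓜 (P.sel s i)) H (P.roundPi s) (P.roundNu s) 0 x₁)
    rw [abs_sub_comm] at h4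
    linarith

end Rounds

/-! ### Failure probability of one round. -/

section Concentration

variable {S A ι γ : Type*} [MeasurableSpace S] [MeasurableSpace A] {𝓜 : ι → MarkovGame S A}
  {H : ℕ} {x₁ : S} {ε : ℝ}

/-- A bound of the probability that the samples of a round are not accurate. -/
noncomputable def roundFailure (H N : ℕ) (ε φ : ℝ) (n₁ n : ℕ) : ℝ :=
  2 * Real.exp (-(n₁ * (ε / 8) ^ 2 / (2 * (H : ℝ) ^ 2))) +
    2 * H * (2 * Real.exp (-(n₁ * (ε / (8 * H)) ^ 2 / (2 * 4 ^ 2)))) +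
    N * H * (2 * Real.exp (-(n * φ ^ 2 / (2 * 2 ^ 2))))

theorem roundFailure_nonneg (H N : ℕ) (ε φ : ℝ) (n₁ n : ℕ) : 0 ≤ roundFailure H N ε φ n₁ n := by
  unfold roundFailure
  positivity

/-- Hoeffding and a union bound over one return (bounded by `H`), `2 * H` Bellman misfits (bounded
by 4) and the misfits of all models, test functions and steps (bounded by 2). All steps are included
because the one used is selected from the first batch. -/
theorem measureReal_compl_accurateSamples_le [Fintype ι] [Fintype γ] (P : Planner 𝓜 H x₁ ε)
    (hε : 0 < ε) (hr : ∀ m, ∀ h < H, ∀ y, |(𝓜 m).reward h y| ≤ 1)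
    (hV : ∀ m π ν h x, |value (𝓜 m) H π ν h x| ≤ 1)
    {g : γ → Obs S A → ℝ} (hg : ∀ c, Measurable (g c)) (hg1 : ∀ c z, |g c z| ≤ 1) {φ : ℝ}
    (hφ : 0 ≤ φ) {n₁ n : ℕ} (hn₁ : 0 < n₁) (hn : 0 < n) (hH : 0 < H) (mstar : ι) (s : Finset ι) :
    ((Measure.pi fun _ : Fin n₁ => trajLaw (𝓜 mstar) (P.roundPi s) (P.roundNu s) H 0 x₁).prod
      (Measure.pi fun _ : Fin n => trajLaw (𝓜 mstar) (P.roundPi s) (P.roundNu s) H 0 x₁)).real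
        (accurateSamples (𝓜 mstar) P g φ n₁ n s)ᶜ ≤
      roundFailure H (Fintype.card ι * Fintype.card γ) ε φ n₁ n := by
  set π := P.roundPi s
  set ν := P.roundNu s
  set μ := trajLaw (𝓜 mstar) π ν H 0 x₁ with hμ
  have hae : ∀ (P : ℕ → Obs S A → Prop), (∀ j, MeasurableSet {z | P j z}) →
      (∀ j < H, ∀ x, ∀ᵐ z ∂(stepLaw (𝓜 mstar) π ν j x), P j z) →
      ∀ᵐ τ ∂μ, ∀ i : Fin H, P i (τ i) := by
    intro P h1 h2
    simpa using ae_trajLaw (𝓜 mstar) π ν h1 H 0 x₁ fun j _ hj x => h2 j (by simpa using hj) x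
  set B₀ : Set (Fin n₁ → Fin H → Obs S A) := {D | ε / 8 <
    |(n₁ : ℝ)⁻¹ * ∑ j, (∑ h, (D j h).2.1) - ∫ τ, ∑ h, (τ h).2.1 ∂μ|}
  set B₁ : Fin 2 × Fin H → Set (Fin n₁ → Fin H → Obs S A) := fun q => {D | ε / (8 * H) <
    |(n₁ : ℝ)⁻¹ * ∑ j, misfit (𝓜 (P.sel s q.1)) q.2
        (bellmanTest (𝓜 (P.sel s q.1)) H π ν q.2) (D j q.2) -
      ∫ τ, misfit (𝓜 (P.sel s q.1)) q.2 (bellmanTest (𝓜 (P.sel s q.1)) H π ν q.2) (τ q.2) ∂μ|}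
  set B₂ : (ι × γ) × Fin H → Set (Fin n → Fin H → Obs S A) := fun q => {D | φ <
    |(n : ℝ)⁻¹ * ∑ j, misfit (𝓜 q.1.1) q.2 (g q.1.2) (D j q.2) -
      ∫ τ, misfit (𝓜 q.1.1) q.2 (g q.1.2) (τ q.2) ∂μ|}
  have hsub : (accurateSamples (𝓜 mstar) P g φ n₁ n s)ᶜ ⊆
      ((B₀ ∪ ⋃ q, B₁ q) ×ˢ Set.univ) ∪ (Set.univ ×ˢ ⋃ q, B₂ q) := by
    intro D hD
    by_contra hnot
    simp only [Set.mem_union, Set.mem_prod, Set.mem_univ, and_true, true_and, Set.mem_iUnion,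
      not_or, not_exists] at hnot
    obtain ⟨⟨h0, h1⟩, h2⟩ := hnot
    exact hD ⟨not_lt.1 h0, fun i h => not_lt.1 (h1 (i, h)), fun m c h => not_lt.1 (h2 ((m, c), h))⟩
  have hB₀ : (Measure.pi fun _ : Fin n₁ => μ).real B₀ ≤
      2 * Real.exp (-(n₁ * (ε / 8) ^ 2 / (2 * (H : ℝ) ^ 2))) := by
    refine measureReal_empMean_sub_gt_le μ (measurable_sum_reward H)
      (b := H) (by exact_mod_cast hH) ?_ hn₁ (by positivity)
    filter_upwards [ae_trajLaw_reward_le (𝓜 mstar) π ν H 0 x₁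
      fun j hj => hr mstar j (by simpa using hj)] with τ hτ using abs_sum_reward_le hτ
  have hB₁ : ∀ q, (Measure.pi fun _ : Fin n₁ => μ).real (B₁ q) ≤
      2 * Real.exp (-(n₁ * (ε / (8 * H)) ^ 2 / (2 * 4 ^ 2))) := by
    intro q
    have hm : ∀ j, Measurable (misfit (𝓜 (P.sel s q.1)) j
        (bellmanTest (𝓜 (P.sel s q.1)) H π ν j)) := fun j =>
      measurable_misfit _ _ (measurable_bellmanTest _ _ _ _ _)
    refine measureReal_empMean_sub_gt_le μ
      (f := fun τ => misfit (𝓜 (P.sel s q.1)) q.2 (bellmanTest (𝓜 (P.sel s q.1)) H π ν q.2) (τ q.2))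
      ((hm q.2).comp (measurable_pi_apply q.2)) (by norm_num) ?_ hn₁ (by positivity)
    filter_upwards [hae (fun _ z => |z.2.1| ≤ 1)
      (fun _ => measurableSet_le (by fun_prop) measurable_const)
      fun j hj x => ae_stepLaw_reward_le _ _ _ _ _ (hr mstar j hj)] with τ hτ
    exact abs_misfit_bellmanTest_le _ (hr _ _ q.2.2) (hV _ _ _) (hτ q.2)
  have hB₂ : ∀ q, (Measure.pi fun _ : Fin n => μ).real (B₂ q) ≤
      2 * Real.exp (-(n * φ ^ 2 / (2 * 2 ^ 2))) := by
    intro q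
    refine measureReal_empMean_sub_gt_le μ
      (f := fun τ => misfit (𝓜 q.1.1) q.2 (g q.1.2) (τ q.2))
      ((measurable_misfit _ _ (hg _)).comp (measurable_pi_apply q.2)) (by norm_num)
      (Filter.Eventually.of_forall fun τ => ?_) hn hφ
    simpa using abs_misfit_le (𝓜 q.1.1) q.2 (f := g q.1.2) (b := 1) (z := τ q.2)
      (Filter.Eventually.of_forall fun y => hg1 _ _) (hg1 _ _)
  have hU₁ : (Measure.pi fun _ : Fin n₁ => μ).real (⋃ q, B₁ q) ≤
      2 * H * (2 * Real.exp (-(n₁ * (ε / (8 * H)) ^ 2 / (2 * 4 ^ 2)))) := by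
    refine (measureReal_iUnion_fintype_le _).trans ((Finset.sum_le_sum fun q _ => hB₁ q).trans ?_)
    simp
  have hU₂ : (Measure.pi fun _ : Fin n => μ).real (⋃ q, B₂ q) ≤
      (Fintype.card ι * Fintype.card γ : ℕ) * H * (2 * Real.exp (-(n * φ ^ 2 / (2 * 2 ^ 2)))) := by
    refine (measureReal_iUnion_fintype_le _).trans ((Finset.sum_le_sum fun q _ => hB₂ q).trans ?_)
    simp
  calc _ ≤ _ := measureReal_mono hsub
    _ ≤ _ := measureReal_union_le _ _
    _ = (Measure.pi fun _ : Fin n₁ => μ).real (B₀ ∪ ⋃ q, B₁ q) +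
        (Measure.pi fun _ : Fin n => μ).real (⋃ q, B₂ q) := by
      rw [measureReal_prod_prod, measureReal_prod_prod]
      simp
    _ ≤ _ := by
      unfold roundFailure
      have := measureReal_union_le (μ := Measure.pi fun _ : Fin n₁ => μ) B₀ (⋃ q, B₁ q)
      linarith

end Concentration

/-! ### Union bound along the Markov chain of statuses. -/

section Chain

/-- The next state can miss `R'` either because the present one is outside `R`, where the transition
probability is bounded by 1, or by a failure of probability at most `δ` from inside `R`. -/
theorem bind_compl_le {Ω : Type*} [MeasurableSpace Ω] [DiscreteMeasurableSpace Ω] {μ : Measure Ω}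
    [IsProbabilityMeasure μ] {K : Ω → Measure Ω} [∀ ω, IsProbabilityMeasure (K ω)] {R R' : Set Ω}
    {δ : ENNReal} (h : ∀ ω ∈ R, K ω R'ᶜ ≤ δ) : (μ.bind K) R'ᶜ ≤ μ Rᶜ + δ := by
  rw [Measure.bind_apply (MeasurableSet.of_discrete) (Measurable.of_discrete).aemeasurable]
  calc ∫⁻ ω, K ω R'ᶜ ∂μ ≤ ∫⁻ ω, (Rᶜ.indicator 1 ω + δ) ∂μ := by
        refine lintegral_mono fun ω => ?_
        by_cases hω : ω ∈ R
        · exact (h ω hω).trans le_add_self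
        · have : ω ∈ Rᶜ := hω
          rw [Set.indicator_of_mem this]
          exact prob_le_one.trans le_self_add
    _ = μ Rᶜ + δ := by
        rw [lintegral_add_right _ measurable_const,
          lintegral_indicator_one MeasurableSet.of_discrete]
        simp

variable {S A ι γ : Type*} [MeasurableSpace S] [MeasurableSpace A] {𝓜 : ι → MarkovGame S A}
  {H : ℕ} {x₁ : S} {ε : ℝ}

instance : DiscreteMeasurableSpace (Status ι) := ⟨fun _ => trivial⟩

theorem Planner.isProbabilityMeasure_next [Finite ι] [Finite γ] (Mtrue : MarkovGame S A)
    (P : Planner 𝓜 H x₁ ε) {g : γ → Obs S A → ℝ} (hg : ∀ c, Measurable (g c)) (φ : ℝ) (n₁ n : ℕ)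
    (st : Status ι) : IsProbabilityMeasure (P.next Mtrue g φ n₁ n st) := by
  cases st with
  | running s used =>
    exact Measure.isProbabilityMeasure_map (P.measurable_round hg φ s used).aemeasurable
  | output m used => exact Measure.dirac.isProbabilityMeasure
  | failed => exact Measure.dirac.isProbabilityMeasure

theorem Planner.isProbabilityMeasure_run [Fintype ι] [Finite γ] (Mtrue : MarkovGame S A)
    (P : Planner 𝓜 H x₁ ε) {g : γ → Obs S A → ℝ} (hg : ∀ c, Measurable (g c)) (φ : ℝ) (n₁ n : ℕ)
    (k : ℕ) : IsProbabilityMeasure (P.run Mtrue g φ n₁ n k) := by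
  have hnext := P.isProbabilityMeasure_next Mtrue hg φ n₁ n
  induction k with
  | zero => exact Measure.dirac.isProbabilityMeasure
  | succ k ih =>
    exact isProbabilityMeasure_bind Measurable.of_discrete.aemeasurable
      (Filter.Eventually.of_forall hnext)

/-- The statuses after `k` rounds with accurate samples, for an invariant `I` of the constraint
sets. -/
def goodStatus (Mtrue : MarkovGame S A) (P : Planner 𝓜 H x₁ ε) (n₁ n : ℕ)
    (I : ℕ → Finset ι → Prop) (k : ℕ) : Set (Status ι) :=
  {st | (∃ s, st = Status.running s (k * (n₁ + n)) ∧ I k s) ∨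
    ∃ m, ∃ j < k, st = Status.output m (j * (n₁ + n) + n₁) ∧
      gameValue Mtrue H x₁ - worstValue Mtrue H x₁ (P.pi m) ≤ ε}

/-- If accurate samples preserve the invariant `I`, then the status is good after `k` rounds up to
`k` times the failure probability of a round. -/
theorem Planner.run_compl_goodStatus_le [Fintype ι] [Fintype γ] [Nonempty γ]
    (P : Planner 𝓜 H x₁ ε)
    (hε : 0 < ε) (hr : ∀ m, ∀ h < H, ∀ y, |(𝓜 m).reward h y| ≤ 1)
    (hV : ∀ m π ν h x, |value (𝓜 m) H π ν h x| ≤ 1)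
    {g : γ → Obs S A → ℝ} (hg : ∀ c, Measurable (g c)) (hg1 : ∀ c z, |g c z| ≤ 1) {φ : ℝ}
    (hφ : 0 ≤ φ) {n₁ n : ℕ} (hn₁ : 0 < n₁) (hn : 0 < n) (hH : 0 < H) (mstar : ι)
    {I : ℕ → Finset ι → Prop} (hI₀ : I 0 Finset.univ) (hmem : ∀ k s, I k s → mstar ∈ s)
    (hI : ∀ k s, I k s → ∀ s' ⊆ s, mstar ∈ s' → ∀ h i,
      ε / (8 * H) ≤ |bellmanError (𝓜 mstar) (𝓜 (P.sel s i)) H x₁ (P.roundPi s) (P.roundNu s) h| →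
      (∀ m ∈ s', witnessMisfit (𝓜 mstar) (𝓜 m) H x₁ g (P.roundPi s) (P.roundNu s) h ≤ 2 * φ) →
      I (k + 1) s') (k : ℕ) :
    (P.run (𝓜 mstar) g φ n₁ n k) (goodStatus (𝓜 mstar) P n₁ n I k)ᶜ ≤
      k * ENNReal.ofReal (roundFailure H (Fintype.card ι * Fintype.card γ) ε φ n₁ n) := by
  have hnext := P.isProbabilityMeasure_next (𝓜 mstar) hg φ n₁ n
  have hrun := P.isProbabilityMeasure_run (𝓜 mstar) hg φ n₁ n
  induction k with
  | zero =>
    have : Status.running Finset.univ 0 ∈ goodStatus (𝓜 mstar) P n₁ n I 0 :=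
      Or.inl ⟨_, by simp, hI₀⟩
    simp [Planner.run, Measure.dirac_apply' _ MeasurableSet.of_discrete, this]
  | succ k ih =>
    have step := bind_compl_le (μ := P.run (𝓜 mstar) g φ n₁ n k) (K := P.next (𝓜 mstar) g φ n₁ n)
      (R := goodStatus (𝓜 mstar) P n₁ n I k) (R' := goodStatus (𝓜 mstar) P n₁ n I (k + 1))
      (δ := ENNReal.ofReal (roundFailure H (Fintype.card ι * Fintype.card γ) ε φ n₁ n)) ?_
    · refine step.trans ((add_le_add_left ih _).trans_eq ?_)
      push_cast
      ring
    · rintro st (⟨s, rfl, hs⟩ | ⟨m, j, hj, rfl, hgap⟩)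
      · have hround := measureReal_compl_accurateSamples_le P hε hr hV hg hg1 hφ hn₁ hn hH mstar s
        rw [Planner.next, Measure.map_apply (P.measurable_round hg φ s _) MeasurableSet.of_discrete]
        refine (measure_mono ?_).trans
          (ENNReal.le_ofReal_iff_toReal_le (measure_ne_top _ _) (roundFailure_nonneg ..) |>.2 hround)
        intro D hD hacc
        apply hD
        rcases P.round_of_mem_accurateSamples hε hr hV hg hg1 (hmem k s hs) (k * (n₁ + n)) hacc with
          ⟨h1, h2⟩ | ⟨s', hs', hm', h1, h, i, h2, h3⟩
        · exact Or.inr ⟨_, k, k.lt_succ_self, h1, h2⟩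
        · refine Or.inl ⟨s', h1.trans ?_, hI k s hs s' hs' hm' h i h2 h3⟩
          congr 1
          ring
      -- Outputs are absorbing, so a good output stays good.
      · have : Status.output m (j * (n₁ + n) + n₁) ∈ goodStatus (𝓜 mstar) P n₁ n I (k + 1) :=
          Or.inr ⟨m, j, by omega, rfl, hgap⟩
        simp [Planner.next, Measure.dirac_apply' _ MeasurableSet.of_discrete, this]

end Chain

/-! ### Numerical estimates for the parameters. -/

section Parameters

variable {H W : ℕ} {κ β ε p : ℝ}

theorem tol_pos (hH : 0 < H) (hW : 1 ≤ W) (hκ : 0 < κ) (hε : 0 < ε) : 0 < tol H W κ ε := by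
  have : (0 : ℝ) < H := by exact_mod_cast hH
  have : (0 : ℝ) < W := by exact_mod_cast hW
  unfold tol
  positivity

theorem sq_tol (H W : ℕ) (κ ε : ℝ) :
    tol H W κ ε ^ 2 = (κ * ε) ^ 2 / (10000 * (H : ℝ) ^ 2 * W) := by
  unfold tol
  rw [div_pow, mul_pow (100 * (H : ℝ)), Real.sq_sqrt (by positivity)]
  ring

/-- The factor 100 in `tol` provides the gap needed by `HasEllipsoid.cut`: $22\cdot 4/100^2<1/64$.
-/
theorem sq_tol_le (hH : 0 < H) (hW : 1 ≤ W) :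
    22 * W * (2 * tol H W κ ε) ^ 2 ≤ (κ * ε / (8 * H)) ^ 2 := by
  have : (0 : ℝ) < H := by exact_mod_cast hH
  have : (0 : ℝ) < W := by exact_mod_cast hW
  have e1 : 22 * W * (2 * tol H W κ ε) ^ 2 = (κ * ε / H) ^ 2 * (88 / 10000) := by
    rw [mul_pow, sq_tol]
    field_simp
    ring
  have e2 : (κ * ε / (8 * H)) ^ 2 = (κ * ε / H) ^ 2 * (1 / 64) := by
    field_simp
    ring
  rw [e1, e2]
  exact mul_le_mul_of_nonneg_left (by norm_num) (sq_nonneg _)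

/-- For the least admissible `β` the ratio equals $\tfrac{25}{4}\sqrt W$. This keeps the logarithm,
and thus `T`, away from zero. -/
theorem le_div_tol (hH : 0 < H) (hW : 1 ≤ W) (hκ : 0 < κ) (hε : 0 < ε)
    (hβ : κ * ε / (8 * H) ≤ β) : 25 / 4 ≤ β / (2 * tol H W κ ε) := by
  have hφ := tol_pos hH hW hκ hε
  have hH' : (0 : ℝ) < H := by exact_mod_cast hH
  have hW' : (1 : ℝ) ≤ √(W : ℝ) := Real.one_le_sqrt.2 (by exact_mod_cast hW)
  rw [le_div_iff₀ (by positivity)]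
  refine le_trans ?_ hβ
  have e : 25 / 4 * (2 * tol H W κ ε) = κ * ε / (8 * H) * (√(W : ℝ))⁻¹ := by
    unfold tol
    field_simp
    norm_num
  rw [e]
  exact mul_le_of_le_one_right (by positivity) (inv_le_one_of_one_le₀ hW')

theorem le_log_div_tol (hH : 0 < H) (hW : 1 ≤ W) (hκ : 0 < κ) (hε : 0 < ε)
    (hβ : κ * ε / (8 * H) ≤ β) : 3 / 2 ≤ Real.log (β / (2 * tol H W κ ε)) := by
  have h1 := le_div_tol hH hW hκ hε hβ
  rw [Real.le_log_iff_exp_le (by linarith)]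
  refine le_trans ?_ h1
  have h2 : Real.exp (3 / 2) ^ 2 = Real.exp 1 ^ 3 := by
    rw [← Real.exp_nat_mul, ← Real.exp_nat_mul]
    norm_num
  have h3 : Real.exp 1 ^ 3 ≤ (25 / 4) ^ 2 := by
    have h1 := Real.exp_one_lt_d9.le
    have h0 := (Real.exp_pos 1).le
    calc Real.exp 1 ^ 3 ≤ 2.7182818286 ^ 3 := by gcongr
      _ ≤ (25 / 4) ^ 2 := by norm_num
  rw [← h2] at h3
  exact le_of_sq_le_sq h3 (by norm_num)

theorem le_rounds (hH : 0 < H) (hW : 1 ≤ W) (hκ : 0 < κ) (hε : 0 < ε)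
    (hβ : κ * ε / (8 * H) ≤ β) : 3 / 2 * H ≤ rounds H W κ β ε := by
  have h1 := le_log_div_tol hH hW hκ hε hβ
  have hW' : (1 : ℝ) ≤ W := by exact_mod_cast hW
  unfold rounds
  have h2 : (H : ℝ) * 1 * (3 / 2) ≤ H * W * Real.log (β / (2 * tol H W κ ε)) := by gcongr
  linarith

theorem exp_neg_le_inv_pow {X y : ℝ} (hX : 0 < X) (h : 9 * Real.log X ≤ y) :
    Real.exp (-y) ≤ (X ^ 9)⁻¹ := by
  have : X ^ 9 = Real.exp (9 * Real.log X) := by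
    rw [← Real.exp_log hX, ← Real.exp_nat_mul, Real.log_exp]
    norm_num
  rw [this, ← Real.exp_neg]
  exact Real.exp_le_exp.2 (by linarith)

theorem third_le_log {X : ℝ} (hX : 3 / 2 ≤ X) : 1 / 3 ≤ Real.log X := by
  have h := Real.one_sub_inv_le_log_of_pos (show 0 < X by linarith)
  have : X⁻¹ ≤ (3 / 2 : ℝ)⁻¹ := inv_anti₀ (by norm_num) hX
  norm_num at this
  linarith

/-- The failure probabilities of all rounds add up to at most `p`. -/
theorem mul_roundFailure_le {C : ℝ} (hC : 1000000 ≤ C) {T : ℝ} {N cA n₁ n k : ℕ} {φ : ℝ}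
    (hH : 0 < H) (hW : 1 ≤ W) (hκ : 0 < κ) (hε : 0 < ε) (hp : 0 < p) (hp1 : p ≤ 1)
    (hT : 3 / 2 * H ≤ T) (hN : 1 ≤ N) (hA : 1 ≤ cA)
    (hφ : φ ^ 2 = (κ * ε) ^ 2 / (10000 * (H : ℝ) ^ 2 * W))
    (hn₁ : C * H ^ 2 * Real.log (H * T / p) / ε ^ 2 ≤ n₁)
    (hn : C * H ^ 2 * W * cA * Real.log (T * N / p) / (κ * ε) ^ 2 ≤ n) (hk : k ≤ T + 1) :
    k * roundFailure H N ε φ n₁ n ≤ p := by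
  have hH1 : (1 : ℝ) ≤ H := by exact_mod_cast hH
  have hW1 : (1 : ℝ) ≤ W := by exact_mod_cast hW
  have hN1 : (1 : ℝ) ≤ N := by exact_mod_cast hN
  have hA1 : (1 : ℝ) ≤ cA := by exact_mod_cast hA
  have hT1 : 3 / 2 ≤ T := by linarith
  have hT0 : 0 < T := by linarith
  set X := H * T / p with hX
  set Y := T * N / p with hY
  have hXT : T ≤ X := by
    rw [hX, le_div_iff₀ hp]; nlinarith
  have hYT : T ≤ Y := by
    rw [hY, le_div_iff₀ hp]; nlinarith
  have hlX := third_le_log (hT1.trans hXT)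
  have hlY := third_le_log (hT1.trans hYT)
  have e1 : Real.exp (-(n₁ * (ε / 8) ^ 2 / (2 * (H : ℝ) ^ 2))) ≤ (X ^ 9)⁻¹ := by
    refine exp_neg_le_inv_pow (hT0.trans_le hXT) ?_
    calc 9 * Real.log X ≤ C / 128 * Real.log X := by gcongr; linarith
      _ = (C * H ^ 2 * Real.log X / ε ^ 2) * (ε / 8) ^ 2 / (2 * (H : ℝ) ^ 2) := by
        field_simp; norm_num
      _ ≤ _ := by gcongr
  have e2 : Real.exp (-(n₁ * (ε / (8 * H)) ^ 2 / (2 * 4 ^ 2))) ≤ (X ^ 9)⁻¹ := by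
    refine exp_neg_le_inv_pow (hT0.trans_le hXT) ?_
    calc 9 * Real.log X ≤ C / 2048 * Real.log X := by gcongr; linarith
      _ = (C * H ^ 2 * Real.log X / ε ^ 2) * (ε / (8 * H)) ^ 2 / (2 * 4 ^ 2) := by
        field_simp; norm_num
      _ ≤ _ := by gcongr
  -- This term determines the size of `C`: the exponent is at least `C / 80000 * log Y`, and `C /
  -- 80000 ≥ 9` is required.
  have e3 : Real.exp (-(n * φ ^ 2 / (2 * 2 ^ 2))) ≤ (Y ^ 9)⁻¹ := by
    refine exp_neg_le_inv_pow (hT0.trans_le hYT) ?_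
    calc 9 * Real.log Y ≤ C / 80000 * 1 * Real.log Y := by gcongr; linarith
      _ ≤ C / 80000 * cA * Real.log Y := by gcongr
      _ = (C * H ^ 2 * W * cA * Real.log Y / (κ * ε) ^ 2) *
          ((κ * ε) ^ 2 / (10000 * (H : ℝ) ^ 2 * W)) / (2 * 2 ^ 2) := by
        field_simp; norm_num
      _ ≤ _ := by rw [hφ]; gcongr
  have hX0 : 0 < X := hT0.trans_le hXT
  have hY0 : 0 < Y := hT0.trans_le hYT
  -- `X` and `Y` are only known to be at least 3/2. The exponent 9 leaves spare powers large enough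
  -- to absorb the constants 12 and 4, besides the powers cancelling `H * T`, `T * N` and `H`.
  have hX8 : 25 ≤ X ^ 8 := by
    calc (25 : ℝ) ≤ (3 / 2) ^ 8 := by norm_num
      _ ≤ X ^ 8 := by gcongr; linarith
  have hY7 : 16 ≤ Y ^ 7 := by
    calc (16 : ℝ) ≤ (3 / 2) ^ 7 := by norm_num
      _ ≤ Y ^ 7 := by gcongr; linarith
  have f1 : 12 * (H * T) * (X ^ 9)⁻¹ ≤ p / 2 := by
    have : H * T = X * p := by rw [hX]; field_simp
    rw [this]
    calc 12 * (X * p) * (X ^ 9)⁻¹ = 12 * p * (X ^ 8)⁻¹ := by field_simp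
      _ ≤ 12 * p * (25)⁻¹ := by gcongr
      _ ≤ p / 2 := by linarith
  have f2 : 4 * (T * N) * H * (Y ^ 9)⁻¹ ≤ p / 2 := by
    have : T * N = Y * p := by rw [hY]; field_simp
    rw [this]
    have hHY : (H : ℝ) ≤ Y := by linarith
    calc 4 * (Y * p) * H * (Y ^ 9)⁻¹ ≤ 4 * (Y * p) * Y * (Y ^ 9)⁻¹ := by gcongr
      _ = 4 * p * (Y ^ 7)⁻¹ := by field_simp
      _ ≤ 4 * p * (16)⁻¹ := by gcongr
      _ ≤ p / 2 := by linarith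
  have hk' : (k : ℝ) ≤ 2 * T := by linarith
  calc k * roundFailure H N ε φ n₁ n
      ≤ (2 * T) * (2 * (X ^ 9)⁻¹ + 2 * H * (2 * (X ^ 9)⁻¹) + N * H * (2 * (Y ^ 9)⁻¹)) := by
        unfold roundFailure
        gcongr
    _ = (4 * T + 8 * (H * T)) * (X ^ 9)⁻¹ + 4 * (T * N) * H * (Y ^ 9)⁻¹ := by ring
    _ ≤ 12 * (H * T) * (X ^ 9)⁻¹ + 4 * (T * N) * H * (Y ^ 9)⁻¹ := by
        gcongr
        nlinarith
    _ ≤ p := by linarith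

/-- The number of sampled trajectories. -/
theorem used_le {C : ℝ} (hC : 1000000 ≤ C) {T : ℝ} {N cA n₁ n j : ℕ}
    (hH : 0 < H) (hW : 1 ≤ W) (hκ : 0 < κ) (hκ1 : κ ≤ 1) (hε : 0 < ε) (hε1 : ε ≤ 1)
    (hp : 0 < p) (hp1 : p ≤ 1) (hT : 3 / 2 * H ≤ T) (hN : 1 ≤ N) (hA : 1 ≤ cA)
    (hn₁ : n₁ = ⌈C * H ^ 2 * Real.log (H * T / p) / ε ^ 2⌉₊)
    (hn : n = ⌈C * H ^ 2 * W * cA * Real.log (T * N / p) / (κ * ε) ^ 2⌉₊) (hj : j ≤ T) :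
    ((j * (n₁ + n) + n₁ : ℕ) : ℝ) ≤
      12 * C * (H ^ 2 * W * cA / (κ ^ 2 * ε ^ 2)) * T * Real.log (T * N / p) := by
  have hH1 : (1 : ℝ) ≤ H := by exact_mod_cast hH
  have hW1 : (1 : ℝ) ≤ W := by exact_mod_cast hW
  have hN1 : (1 : ℝ) ≤ N := by exact_mod_cast hN
  have hA1 : (1 : ℝ) ≤ cA := by exact_mod_cast hA
  have hT1 : 3 / 2 ≤ T := by linarith
  have hT0 : 0 < T := by linarith
  have hC0 : 0 < C := by linarith
  set X := H * T / p with hX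
  set Y := T * N / p with hY
  have hXT : T ≤ X := by
    rw [hX, le_div_iff₀ hp]; nlinarith
  have hYT : T ≤ Y := by
    rw [hY, le_div_iff₀ hp]; nlinarith
  have hlX := third_le_log (hT1.trans hXT)
  have hlY := third_le_log (hT1.trans hYT)
  have hX0 : 0 < X := hT0.trans_le hXT
  have hY0 : 0 < Y := hT0.trans_le hYT
  -- Since `H ≤ T ≤ Y` and `T / p ≤ Y`, one has `X ≤ Y ^ 2`; the first batch is thus dominated by
  -- the second up to a constant.
  have hXY : Real.log X ≤ 2 * Real.log Y := by
    have : X ≤ Y ^ 2 := by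
      have hYp : T / p ≤ Y := by
        rw [hY]; gcongr; nlinarith
      have hHY : (H : ℝ) ≤ Y := by linarith
      calc X = H * (T / p) := by rw [hX]; ring
        _ ≤ Y * Y := by gcongr
        _ = Y ^ 2 := by ring
    calc Real.log X ≤ Real.log (Y ^ 2) := Real.log_le_log hX0 this
      _ = 2 * Real.log Y := by rw [Real.log_pow]; norm_num
  have hκε : (κ * ε) ^ 2 ≤ ε ^ 2 := by
    rw [mul_pow]
    exact mul_le_of_le_one_left (by positivity) (pow_le_one₀ hκ.le hκ1)
  have hε2 : ε ^ 2 ≤ 1 := pow_le_one₀ hε.le hε1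
  set Q := C * H ^ 2 * W * cA * Real.log Y / (κ * ε) ^ 2 with hQ
  set R := C * H ^ 2 * Real.log X / ε ^ 2 with hR
  have hH2 : (1 : ℝ) ≤ (H : ℝ) ^ 2 := one_le_pow₀ hH1
  -- Once `R` and `Q` are at least 1, rounding up at most doubles them.
  have hR1 : 1 ≤ R := by
    rw [hR, le_div_iff₀ (by positivity), one_mul]
    calc ε ^ 2 ≤ 1 := hε2
      _ ≤ C * 1 * (1 / 3) := by linarith
      _ ≤ _ := by gcongr
  have hRQ : R ≤ 2 * Q := by
    calc R ≤ C * H ^ 2 * (2 * Real.log Y) / (κ * ε) ^ 2 := by rw [hR]; gcongr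
      _ = 2 * (C * H ^ 2 * 1 * 1 * Real.log Y / (κ * ε) ^ 2) := by ring
      _ ≤ 2 * Q := by rw [hQ]; gcongr
  have hQ1 : 1 ≤ Q := by
    rw [hQ, le_div_iff₀ (by positivity), one_mul]
    calc (κ * ε) ^ 2 ≤ 1 := hκε.trans hε2
      _ ≤ C * 1 * 1 * 1 * (1 / 3) := by linarith
      _ ≤ _ := by gcongr
  have h1 : (n₁ : ℝ) ≤ 2 * R := by
    have := Nat.ceil_lt_add_one (show 0 ≤ R by linarith)
    rw [hn₁]; linarith
  have h2 : (n : ℝ) ≤ 2 * Q := by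
    have := Nat.ceil_lt_add_one (show 0 ≤ Q by linarith)
    rw [hn]; linarith
  have h3 : (n₁ : ℝ) + n ≤ 6 * Q := by linarith
  push_cast
  calc (j : ℝ) * (n₁ + n) + n₁ ≤ T * (n₁ + n) + T * (n₁ + n) := by
        gcongr
        have : (0 : ℝ) ≤ n := by positivity
        have : (0 : ℝ) ≤ n₁ := by positivity
        nlinarith
    _ = 2 * T * (n₁ + n) := by ring
    _ ≤ 2 * T * (6 * Q) := by gcongr
    _ = _ := by rw [hQ]; field_simp; norm_num

end Parameters

/-! ### The invariant of the constraint sets and the bound on the number of rounds. -/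

section Elimination

variable {S A ι γ : Type*} [MeasurableSpace S] [MeasurableSpace A] {𝓜 : ι → MarkovGame S A}
  {H : ℕ} {x₁ : S} {ε : ℝ}

/-- The constraint set `s` contains the true model, and the ellipsoids that contain the vectors of
the remaining models have been cut `k` times in total. -/
def EllipsoidInvariant {d : Fin H → ℕ} (V : ∀ h, ι → Fin (d h) → ℝ) (lam : ℝ) (mstar : ι)
    (k : ℕ) (s : Finset ι) : Prop :=
  mstar ∈ s ∧ ∃ c : Fin H → ℕ, ∑ h, c h = k ∧ ∀ h, HasEllipsoid (V h) lam s (c h)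

theorem ellipsoidInvariant_zero {d : Fin H → ℕ} {V : ∀ h, ι → Fin (d h) → ℝ} {lam : ℝ}
    {mstar : ι} {s : Finset ι} (hs : mstar ∈ s) (hlam : 1 ≤ lam)
    (hV : ∀ h m, V h m ⬝ᵥ V h m ≤ 1) : EllipsoidInvariant V lam mstar 0 s :=
  ⟨hs, fun _ => 0, by simp, fun h => hasEllipsoid_zero hlam fun m _ => hV h m⟩

theorem EllipsoidInvariant.le {d : Fin H → ℕ} {V : ∀ h, ι → Fin (d h) → ℝ} {b : ℝ}
    {mstar : ι} {s : Finset ι} {k W : ℕ} (hI : EllipsoidInvariant V (b ^ 2) mstar k s)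
    (hb : 1 ≤ b) (hd : ∀ h, d h ≤ W) : (k : ℝ) ≤ H * W * Real.log b := by
  obtain ⟨-, c, rfl, hc⟩ := hI
  have hc' : ∀ h, (c h : ℝ) ≤ W * Real.log b := by
    intro h
    have h1 := (hc h).exp_le
    have h2 : (b ^ 2) ^ d h = Real.exp (2 * (d h * Real.log b)) := by
      rw [← pow_mul, ← Real.exp_log (show 0 < b ^ (2 * d h) by positivity), Real.log_pow]
      push_cast
      ring_nf
    rw [h2, Real.exp_le_exp] at h1
    have h3 : (d h : ℝ) * Real.log b ≤ W * Real.log b := by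
      have := Real.log_nonneg hb
      have := hd h
      gcongr
    linarith
  push_cast
  calc ∑ h, (c h : ℝ) ≤ ∑ _h : Fin H, W * Real.log b := Finset.sum_le_sum fun h _ => hc' h
    _ = H * W * Real.log b := by simp; ring

/-- Only the ellipsoid of the step `h` used in the round is cut, by the slab of half-width `2 * φ`
normal to the row of the selected pair. The other ellipsoids still contain the smaller set. -/
theorem EllipsoidInvariant.succ {Mtrue : MarkovGame S A} {P : Planner 𝓜 H x₁ ε}
    {g : γ → Obs S A → ℝ} {κ β φ : ℝ} {W : ℕ} (hH : 0 < H) (hκ : 0 < κ) (hε : 0 < ε) (hφ : 0 < φ)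
    {d : Fin H → ℕ} {U : ∀ h, ι × ι → Fin (d h) → ℝ} {V : ∀ h, ι → Fin (d h) → ℝ}
    (hd : ∀ h, d h ≤ W) (hU : ∀ h q, U h q ⬝ᵥ U h q ≤ β ^ 2)
    (hUV : ∀ h m₁ m₂ m,
        κ * |bellmanError Mtrue (𝓜 m) H x₁ (P.pi m₁) (P.nu m₁ m₂) h| ≤ U h (m₁, m₂) ⬝ᵥ V h m ∧
          U h (m₁, m₂) ⬝ᵥ V h m ≤
            witnessMisfit Mtrue (𝓜 m) H x₁ g (P.pi m₁) (P.nu m₁ m₂) h)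
    (hgap : 22 * W * (2 * φ) ^ 2 ≤ (κ * ε / (8 * H)) ^ 2) {mstar : ι} {k : ℕ} {s s' : Finset ι}
    (hI : EllipsoidInvariant V ((β / (2 * φ)) ^ 2) mstar k s) (hs' : s' ⊆ s) (hm : mstar ∈ s')
    {h : Fin H} {i : Fin 2}
    (hbig : ε / (8 * H) ≤
      |bellmanError Mtrue (𝓜 (P.sel s i)) H x₁ (P.roundPi s) (P.roundNu s) h|)
    (hsmall : ∀ m ∈ s',
      witnessMisfit Mtrue (𝓜 m) H x₁ g (P.roundPi s) (P.roundNu s) h ≤ 2 * φ) :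
    EllipsoidInvariant V ((β / (2 * φ)) ^ 2) mstar (k + 1) s' := by
  obtain ⟨hs, c, hck, hc⟩ := hI
  have hne : s.Nonempty := ⟨mstar, hs⟩
  have hH' : (0 : ℝ) < H := by exact_mod_cast hH
  have hsel : P.sel s i ∈ s := by
    unfold Planner.sel
    split_ifs
    exacts [P.opt_mem s hne, P.pess_mem s hne]
  have hlow : κ * ε / (8 * H) ≤ U h (P.opt s, P.pess s) ⬝ᵥ V h (P.sel s i) := by
    refine le_trans ?_ (hUV h (P.opt s) (P.pess s) (P.sel s i)).1
    rw [mul_div_assoc]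
    exact mul_le_mul_of_nonneg_left hbig hκ.le
  -- The rank at a particular step may be zero, but then all entries vanish and no Bellman error is
  -- large there.
  have hd0 : 0 < d h := by
    rcases Nat.eq_zero_or_pos (d h) with h0 | h0
    · exfalso
      have : IsEmpty (Fin (d h)) := by rw [h0]; infer_instance
      have hz : U h (P.opt s, P.pess s) ⬝ᵥ V h (P.sel s i) = 0 := by simp [dotProduct]
      have : 0 < κ * ε / (8 * H) := by positivity
      linarith
    · exact h0
  have hcut : HasEllipsoid (V h) ((β / (2 * φ)) ^ 2) s' (c h + 1) := by
    refine (hc h).cut hs' hd0 (u := U h (P.opt s, P.pess s)) (r := 2 * φ) (by positivity) ?_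
      ⟨P.sel s i, hsel, ?_⟩ fun m hm => ?_
    · have : (β / (2 * φ)) ^ 2 * (2 * φ) ^ 2 = β ^ 2 := by field_simp
      rw [this]
      exact hU h _
    · have hdW : (d h : ℝ) ≤ W := by exact_mod_cast hd h
      calc 22 * (d h : ℝ) * (2 * φ) ^ 2 ≤ 22 * W * (2 * φ) ^ 2 := by gcongr
        _ ≤ _ := hgap
        _ ≤ _ := by gcongr
    · have h1 := hUV h (P.opt s) (P.pess s) m
      -- The lower bound by `κ` times an absolute value makes the entries nonnegative, so the
      -- one-sided elimination test bounds their squares.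
      have h2 : 0 ≤ U h (P.opt s, P.pess s) ⬝ᵥ V h m :=
        le_trans (by positivity) h1.1
      have h3 := h1.2.trans (hsmall m hm)
      gcongr
  refine ⟨hm, fun j => c j + if j = h then 1 else 0, ?_, fun j => ?_⟩
  · simp [Finset.sum_add_distrib, hck]
  · by_cases hj : j = h
    · subst hj
      simpa using hcut
    · simpa [hj] using (hc j).mono hs'

end Elimination

/-- An empty type carries no probability measure; this gives $|\mathcal A|\ge 1$ for the batch
sizes. -/
theorem Policy.nonempty_action {S A : Type*} [MeasurableSpace S] [MeasurableSpace A]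
    (π : Policy S A) (x : S) : Nonempty A := by
  by_contra hA
  rw [not_nonempty_iff] at hA
  have : π.act 0 x Set.univ = 1 := measure_univ
  simp [Set.univ_eq_empty_iff.2 hA] at this

end AOME

/-! ### The main theorem. -/

theorem mainTheorem3 :
    ∃ C₀ : ℝ, 0 < C₀ ∧ ∀ C : ℝ, C₀ ≤ C → ∃ C' : ℝ, 0 < C' ∧
      ∀ (S A ι γ : Type*) [MeasurableSpace S] [MeasurableSpace A] [MeasurableSingletonClass A]
        [Fintype A] [Fintype ι] [Fintype γ] [Nonempty γ]
        (H W : ℕ) (x₁ : S) (κ β ε p : ℝ)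
        -- the true game, the model class, the class of test functions
        (Mtrue : AOME.MarkovGame S A) (𝓜 : ι → AOME.MarkovGame S A) (g : γ → AOME.Obs S A → ℝ)
        (P : AOME.Planner 𝓜 H x₁ ε),
        0 < ε → ε ≤ 1 → 0 < p → p ≤ 1 → 0 < κ → κ ≤ 1 →
        -- realizability
        Mtrue ∈ Set.range 𝓜 →
        -- normalization of rewards, values and test functions
        (∀ m, ∀ h < H, ∀ y, |(𝓜 m).reward h y| ≤ 1) →
        (∀ m π ν, ∀ h < H, ∀ x, |AOME.value (𝓜 m) H π ν h x| ≤ 1) →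
        (∀ c, Measurable (g c)) → (∀ c z, |g c z| ≤ 1) →
        -- witness-rank domination: the witness rank is finite, with value `W`
        AOME.witnessRank Mtrue P g κ β = (W : ℕ∞) → 1 ≤ W → κ * ε / (8 * H) ≤ β →
        ∃ k : ℕ, 1 - p ≤
          (P.run Mtrue g (AOME.tol H W κ ε) (AOME.batch₁ C H W κ β ε p)
            (AOME.batch₂ C H W (Fintype.card A) (Fintype.card ι) (Fintype.card γ) κ β ε p) k).real
          {s | ∃ m used, s = AOME.Status.output m used ∧
            AOME.gameValue Mtrue H x₁ - AOME.worstValue Mtrue H x₁ (P.pi m) ≤ ε ∧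
            (used : ℝ) ≤ C' * (H ^ 3 * W ^ 2 * Fintype.card A / (κ ^ 2 * ε ^ 2)) *
              Real.log (β / (2 * AOME.tol H W κ ε)) *
              Real.log (AOME.rounds H W κ β ε * Fintype.card γ * Fintype.card ι / p)} := by
  refine ⟨1000000, by norm_num, fun C hC => ⟨12 * C, by linarith, ?_⟩⟩
  intro S A ι γ _ _ _ _ _ _ _ H W x₁ κ β ε p Mtrue 𝓜 g P hε hε1 hp hp1 hκ hκ1 hreal hr hval hg hg1
    hrank hW hβ
  obtain ⟨mstar, rfl⟩ := hreal
  -- The step selection takes values in `Fin H`, so the horizon is positive.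
  have hH : 0 < H := Fin.pos (P.step ∅ fun _ _ => 0)
  have hH' : (0 : ℝ) < H := by exact_mod_cast hH
  have hV : ∀ m π ν h x, |AOME.value (𝓜 m) H π ν h x| ≤ 1 := by
    intro m π ν h x
    rcases lt_or_ge h H with hh | hh
    · exact hval m π ν h hh x
    · simp [AOME.value_of_le (𝓜 m) π ν hh x]
  have hφ := AOME.tol_pos hH hW hκ hε
  have hβ0 : 0 < β := lt_of_lt_of_le (by positivity) hβ
  have hb : 1 ≤ β / (2 * AOME.tol H W κ ε) := by
    linarith [AOME.le_div_tol hH hW hκ hε hβ]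
  have hT := AOME.le_rounds hH hW hκ hε hβ
  have hH1 : (1 : ℝ) ≤ H := by exact_mod_cast hH
  have hA : 1 ≤ Fintype.card A := by
    have := (P.pi mstar).nonempty_action x₁
    exact Fintype.card_pos
  have hι : 1 ≤ Fintype.card ι := by
    have : Nonempty ι := ⟨mstar⟩
    exact Fintype.card_pos
  have hN : 1 ≤ Fintype.card ι * Fintype.card γ := Nat.mul_pos hι Fintype.card_pos
  set T := AOME.rounds H W κ β ε with hTdef
  set n₁ := AOME.batch₁ C H W κ β ε p with hn₁
  set n := AOME.batch₂ C H W (Fintype.card A) (Fintype.card ι) (Fintype.card γ) κ β ε p with hn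
  have hn' : n = ⌈C * H ^ 2 * W * (Fintype.card A : ℕ) *
      Real.log (T * (Fintype.card ι * Fintype.card γ : ℕ) / p) / (κ * ε) ^ 2⌉₊ := by
    rw [hn, AOME.batch₂, Nat.cast_mul, ← mul_assoc T]
  have hlog : ∀ {X : ℝ}, T ≤ X → 0 < Real.log X := fun hX =>
    lt_of_lt_of_le (by norm_num) (AOME.third_le_log (by linarith))
  have hC0 : 0 < C := by linarith
  have hN1 : (1 : ℝ) ≤ (Fintype.card ι * Fintype.card γ : ℕ) := by exact_mod_cast hN
  have hn₁pos : 0 < n₁ := by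
    have := hlog (show T ≤ H * T / p by rw [le_div_iff₀ hp]; nlinarith)
    exact Nat.ceil_pos.2 (by positivity)
  have hnpos : 0 < n := by
    have := hlog (show T ≤ T * (Fintype.card ι * Fintype.card γ : ℕ) / p by
      rw [le_div_iff₀ hp]; nlinarith)
    rw [hn']
    exact Nat.ceil_pos.2 (by positivity)
  choose d hd U V hUV hV1 hU using
    AOME.exists_factorization_of_witnessRank_eq hβ0 hrank
  set I := AOME.EllipsoidInvariant V ((β / (2 * AOME.tol H W κ ε)) ^ 2) mstar with hIdef
  -- The least integer exceeding `T`: after `k` good rounds the status cannot still be running,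
  -- since that would require `k` cuts. An output then comes after at most `⌊T⌋₊` full rounds and
  -- one first batch.
  set k := ⌊T⌋₊ + 1 with hk
  have hT0 : 0 ≤ T := by linarith
  have hkT : T < k := by rw [hk]; exact_mod_cast Nat.lt_floor_add_one T
  have hkT1 : (k : ℝ) ≤ T + 1 := by
    rw [hk]; push_cast; linarith [Nat.floor_le hT0]
  have hfail := P.run_compl_goodStatus_le hε hr hV hg hg1 hφ.le hn₁pos hnpos hH mstar (I := I)
    (AOME.ellipsoidInvariant_zero (Finset.mem_univ _) (one_le_pow₀ hb) hV1)
    (fun _ _ hI => hI.1)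
    (fun _ _ hI _ hs' hm _ _ hbig hsmall => hI.succ hH hκ hε hφ hd hU hUV
      (AOME.sq_tol_le hH hW) hs' hm hbig hsmall) k
  refine ⟨k, ?_⟩
  have := P.isProbabilityMeasure_run (𝓜 mstar) hg (AOME.tol H W κ ε) n₁ n k
  have hfail' : (P.run (𝓜 mstar) g (AOME.tol H W κ ε) n₁ n k).real
      (AOME.goodStatus (𝓜 mstar) P n₁ n I k)ᶜ ≤ p := by
    refine le_trans ?_ (AOME.mul_roundFailure_le hC hH hW hκ hε hp hp1 hT hN hA
      (AOME.sq_tol H W κ ε) (Nat.le_ceil _) (hn' ▸ Nat.le_ceil _) hkT1)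
    rw [← ENNReal.ofReal_natCast k, ← ENNReal.ofReal_mul (by positivity)] at hfail
    exact ENNReal.toReal_le_of_le_ofReal
      (mul_nonneg (by positivity) (AOME.roundFailure_nonneg ..)) hfail
  rw [probReal_compl_eq_one_sub MeasurableSet.of_discrete] at hfail'
  refine le_trans (by linarith) (measureReal_mono ?_)
  rintro st (⟨s, -, hs⟩ | ⟨m, j, hj, rfl, hgap⟩)
  · exact absurd (hs.le hb hd) (not_le.2 hkT)
  · refine ⟨m, _, rfl, hgap, ?_⟩
    have hjT : (j : ℝ) ≤ T := by
      have : j ≤ ⌊T⌋₊ := by omega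
      exact le_trans (by exact_mod_cast this) (Nat.floor_le hT0)
    refine (AOME.used_le hC hH hW hκ hκ1 hε hε1 hp hp1 hT hN hA rfl hn' hjT).trans_eq ?_
    have e : T * (Fintype.card ι * Fintype.card γ : ℕ) / p =
        T * Fintype.card γ * Fintype.card ι / p := by push_cast; ring
    rw [e]
    nth_rewrite 1 [hTdef]
    rw [AOME.rounds]
    ring
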